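/- **Notation.** For $a=(a_0,a_1,a_2;a_3,a_4)\in\mathbb C^5$ put $s(a)=a_3+a_4-a_0-a_1-a_2$ and $$f(a)=\sum_{k\ge 0}\frac{\Gamma(a_0+k)\Gamma(a_1+k)\Gamma(a_2+k)}{\Gamma(1+k)\Gamma(a_3+k)\Gamma(a_4+k)} ,$$ which converges absolutely if $\operatorname{Re}s(a)>0$ and no $a_i$ is an integer. Let $\sigma_0^{(0)}=\mathrm{id}$ and let $$\begin{aligned} \sigma_1^{(0)}(a)&=(a_0+1-a_3,\,a_1+1-a_3,\,a_2+1-a_3;\,2-a_3,\,a_4+1-a_3),\\ \sigma_2^{(0)}(a)&=(a_0+1-a_4,\,a_1+1-a_4,\,a_2+1-a_4;\,a_3+1-a_4,\,2-a_4),\\ \sigma_0^{(\infty)}(a)&=(a_0,\,a_0+1-a_3,\,a_0+1-a_4;\,a_0+1-a_1,\,a_0+1-a_2),\\ \sigma_1^{(\infty)}(a)&=(a_1+1-a_3,\,a_1,\,a_1+1-a_4;\,a_1+1-a_0,\,a_1+1-a_2),\\ \sigma_2^{(\infty)}(a)&=(a_2+1-a_4,\,a_2+1-a_3,\,a_2;\,a_2+1-a_1,\,a_2+1-a_0).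 \end{aligned}$$ These are involutions preserving $s$. The six companion functions are $y_i^{(0)}(a)=f(\sigma_i^{(0)}(a))$ and $y_i^{(\infty)}(a)=e^{\mathrm i\pi s(a)}f(\sigma_i^{(\infty)}(a))$, $i=0,1,2$. They are considered at generic $a$ (no $a_i$ and no $a_i-a_j$ with $i\ne j$ is an integer) with $\operatorname{Re}s(a)>0$; correspondingly, an identity between $h(a)$, $h(a+p)$, $h(a+q)$ with $p,q\in\mathbb Z^5$ is understood at all generic $a$ at which the functions occurring in it are given by convergent series (that is, $\operatorname{Re}s>0$ at the respective arguments) and at which its rational coefficients have no pole. *Contiguous matrices.* Put $\varphi_1=a_0+a_1+a_2$, $\varphi_2=a_0a_1+a_1a_2+a_2a_0$, $\varphi_3=a_0a_1a_2$, $s=s(a)$, let $e_i$ be the unit vectors of $\mathbb Z^5$, and define, for $\{i,j,k\}=\{0,1,2\}$, $$A_i^+(a)=\begin{pmatrix}a_i&1\\ \frac{\varphi_3}{s-2}&\frac{a_ja_k-(a_i-a_3+1)(a_i-a_4+1)}{s-2}\end{pmatrix},\quad A_i^-(a)=\begin{pmatrix}\frac{(a_i-a_3)(a_i-a_4)-a_ja_k}{(a_i-1)(a_i-a_3)(a_i-a_4)}&\frac{s-1}{(a_i-1)(a_i-a_3)(a_i-a_4)}\\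 \frac{a_ja_k}{(a_i-a_3)(a_i-a_4)}&-\frac{s-1}{(a_i-a_3)(a_i-a_4)}\end{pmatrix},$$ and, for $i=3,4$, with $d_i=(a_i-a_0)(a_i-a_1)(a_i-a_2)$, $$A_i^+(a)=\frac1{d_i}\begin{pmatrix}a_i^2-\varphi_1a_i+\varphi_2&-(s-1)\\-\varphi_3&a_i(s-1)\end{pmatrix},\quad A_i^-(a)=\begin{pmatrix}a_i-1&1\\ \frac{\varphi_3}{s-2}&\frac{(a_i-1)^2-\varphi_1(a_i-1)+\varphi_2}{s-2}\end{pmatrix}.$$ Along a lattice path $0=p_0,p_1,\dots,p_m$ with steps $p_k-p_{k-1}=\varepsilon_ke_{i_k}$, $\varepsilon_k=\pm1$, form the product $A_{i_m}^{\varepsilon_m}(a+p_{m-1})\cdots A_{i_1}^{\varepsilon_1}(a)$ over $\mathbb Q(a)$. Also put $(x,n)=\Gamma(x+n)/\Gamma(x)$ for $n\in\mathbb Z$ and $$\delta(a;p)=\frac{(-1)^{p_0+p_1+p_2}\,(s(a)-1,s(p))\prod_{i=0}^2(a_i,p_i)}{\prod_{i=0}^2\prod_{j=3}^4(a_j-a_i,p_j-p_i)}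 .$$ **Theorem 1.1.** Let $p,q\in\mathbb Z^5$, $p\neq q$. 1. For each of the six companion functions $h$, the functions $h(a+p)$ and $h(a+q)$ are linearly independent over $\mathbb C(a)$. 2. For each of the six companion functions $h$ there are unique $u,v\in\mathbb Q(a)$ with $$h(a)=u(a)\,h(a+p)+v(a)\,h(a+q).\qquad(*)$$ 3. These $u,v$ are the same for all six functions $h$. 4. They are given by the following finite recipe. Every $r\in\mathbb Z^5$ is the end point of a lattice path from $0$ of length $\sum_j|r_j|$. Take any lattice path from $0$ to $p$ and any one from $0$ to $q$, and let $(r_1(a;p),r(a;p))$ and $(r_1(a;q),r(a;q))$ be the top rows of the corresponding products of contiguous matrices. Then $\Delta=r_1(a;p)r(a;q)-r(a;p)r_1(a;q)\ne0$ in $\mathbb Q(a)$, and $u=r(a;q)/\Delta$, $v=-r(a;p)/\Delta$. Alternatively, $u=r(a;q)/\big(\delta(a;p)\,r(a+p;q-p)\big)$ and $v=-r(a;p)/\big(\delta(a;p)\,r(a+p;q-p)\big)$, with non-zero denominators, where $r(a+p;q-p)$ is the upper right entry of the product along any lattice path from $0$ to $q-p$, with $a$ replaced by $a+p$. 5. Let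 $G$ be the group of affine transformations of $\mathbb C^5$ generated by the involutions $\sigma_i^{(\nu)}$, and write $\bar\sigma$ for the linear part of $\sigma\in G$. Then $|G|=72$, and there is an isomorphism $\Phi:G\to S_2\ltimes(S_3\times S_3)$, where $S_2$ permutes the two factors $S_3$, independent of $p,q$, which sends $\sigma_0^{(\infty)}$ to the generator of $S_2$ and $\sigma_1^{(0)}$, $\sigma_2^{(0)}$ to the transpositions $(0\,1)$, $(0\,2)$ of the second factor $S_3$. Let $\chi(\sigma)=\pm1$ be the sign of the $S_2$-component of $\Phi(\sigma)$. For every $\sigma\in G$ the vectors $\bar\sigma(p),\bar\sigma(q)$ lie in $\mathbb Z^5$, and for each of the six functions $h$, with $u,v$ as in $(*)$, $$h(a)=\chi(\sigma)^{s(p)}\,u(\sigma^{-1}(a))\,h(a+\bar\sigma(p))+\chi(\sigma)^{s(q)}\,v(\sigma^{-1}(a))\,h(a+\bar\sigma(q)).$$ -/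

import Mathlib

open scoped BigOperators

noncomputable section

namespace ThreeTerm

/-! ### Parameters

A parameter vector `(a₀, a₁, a₂; b₁, b₂) = (a₀, a₁, a₂; a₃, a₄)` is a function `Fin 5 → R`. -/

/-- The Saalschütz index `s(a) = a₃ + a₄ - a₀ - a₁ - a₂`. -/
def saal {R : Type*} [CommRing R] (a : Fin 5 → R) : R := a 3 + a 4 - a 0 - a 1 - a 2

/-- An integer vector, viewed as a vector with entries in `R`. -/
def intVec (R : Type*) [CommRing R] (p : Fin 5 → ℤ) : Fin 5 → R := fun j => (p j : R)

/-- Genericness: no `aᵢ` and no difference `aᵢ - aⱼ` (`i ≠ j`) is an integer. -/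
def Generic (a : Fin 5 → ℂ) : Prop :=
  (∀ i, ∀ n : ℤ, a i ≠ n) ∧ ∀ i j, i ≠ j → ∀ n : ℤ, a i - a j ≠ n

/-- The two singular points `0` and `∞` to which the companion functions are attached. -/
inductive SingPt
  | zero
  | infty

/-- The six parameter involutions `σᵢ^{(0)}`, `σᵢ^{(∞)}`, `i = 0, 1, 2`
(`σ₀^{(0)}` is the identity). -/
def paramMap {R : Type*} [CommRing R] : SingPt → Fin 3 → (Fin 5 → R) → (Fin 5 → R)
  | .zero, 0, a => a
  | .zero, 1, a => ![a 0 + 1 - a 3, a 1 + 1 - a 3, a 2 + 1 - a 3, 2 - a 3, a 4 + 1 - a 3]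
  | .zero, 2, a => ![a 0 + 1 - a 4, a 1 + 1 - a 4, a 2 + 1 - a 4, a 3 + 1 - a 4, 2 - a 4]
  | .infty, 0, a => ![a 0, a 0 + 1 - a 3, a 0 + 1 - a 4, a 0 + 1 - a 1, a 0 + 1 - a 2]
  | .infty, 1, a => ![a 1 + 1 - a 3, a 1, a 1 + 1 - a 4, a 1 + 1 - a 0, a 1 + 1 - a 2]
  | .infty, 2, a => ![a 2 + 1 - a 4, a 2 + 1 - a 3, a 2, a 2 + 1 - a 1, a 2 + 1 - a 0]

/-! ### The hypergeometric functions -/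

/-- The renormalized series
`f(a; z) = ∑ₖ Γ(a₀+k) Γ(a₁+k) Γ(a₂+k) / (Γ(1+k) Γ(a₃+k) Γ(a₄+k)) zᵏ`. -/
def hgf (a : Fin 5 → ℂ) (z : ℂ) : ℂ :=
  ∑' k : ℕ, Complex.Gamma (a 0 + k) * Complex.Gamma (a 1 + k) * Complex.Gamma (a 2 + k) /
    (Complex.Gamma (1 + k) * Complex.Gamma (a 3 + k) * Complex.Gamma (a 4 + k)) * z ^ k

/-- The lower parameters `b₀ = 1, b₁ = a₃, b₂ = a₄`. -/
def lowerParam (a : Fin 5 → ℂ) : Fin 3 → ℂ := ![1, a 3, a 4]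

/-- The upper parameters `a₀, a₁, a₂`. -/
def upperParam (a : Fin 5 → ℂ) : Fin 3 → ℂ := ![a 0, a 1, a 2]

/-- `yᵢ^{(0)}(a; z) = z^{1 - bᵢ} f(σᵢ^{(0)}(a); z)` and
`yᵢ^{(∞)}(a; z) = e^{iπ s(a)} z^{-aᵢ} f(σᵢ^{(∞)}(a); 1/z)`. -/
def solution : SingPt → Fin 3 → (Fin 5 → ℂ) → ℂ → ℂ
  | .zero, i, a, z => z ^ (1 - lowerParam a i) * hgf (paramMap .zero i a) z
  | .infty, i, a, z => Complex.exp (Complex.I * Real.pi * saal a) * z ^ (-(upperParam a i)) *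
      hgf (paramMap .infty i a) (1 / z)

/-- The six companion functions `yᵢ^{(ν)}(a) = yᵢ^{(ν)}(a; 1)`. -/
def companion (ν : SingPt) (i : Fin 3) (a : Fin 5 → ℂ) : ℂ := solution ν i a 1

/-- The domain on which all six functions `h(a + p)` are defined by convergent series:
`a` is generic and `Re s(a + p) > 0`. -/
def domain (p : Fin 5 → ℤ) : Set (Fin 5 → ℂ) :=
  {a | Generic a ∧ 0 < (saal (a + intVec ℂ p)).re}

/-! ### Rational functions of `a₀, …, a₄` and their values -/

/-- The rational function field `K(a) = K(a₀, …, a₄)`. -/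
abbrev RatFun (K : Type*) [Field K] := FractionRing (MvPolynomial (Fin 5) K)

/-- The reduced denominator of `u` does not vanish at the point `a`. -/
def RegularAt {K : Type*} [Field K] [Algebra K ℂ] (u : RatFun K) (a : Fin 5 → ℂ) : Prop :=
  MvPolynomial.aeval a
    (IsFractionRing.den (MvPolynomial (Fin 5) K) u : MvPolynomial (Fin 5) K) ≠ 0

/-- The value of the rational function `u` at a point `a` at which it is regular. -/
def evalAt {K : Type*} [Field K] [Algebra K ℂ] (u : RatFun K) (a : Fin 5 → ℂ) : ℂ :=
  MvPolynomial.aeval a (IsFractionRing.num (MvPolynomial (Fin 5) K) u) /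
    MvPolynomial.aeval a
      (IsFractionRing.den (MvPolynomial (Fin 5) K) u : MvPolynomial (Fin 5) K)

/-- Two functions `F`, `G` on `D` are linearly independent over the field `ℂ(a)`. -/
def LinIndepOverRat (D : Set (Fin 5 → ℂ)) (F G : (Fin 5 → ℂ) → ℂ) : Prop :=
  ∀ U V : RatFun ℂ,
    (∀ a ∈ D, RegularAt U a → RegularAt V a → evalAt U a * F a + evalAt V a * G a = 0) →
      U = 0 ∧ V = 0

/-- The three-term relation `h(a) = u(a) h(a + p) + v(a) h(a + q)`, at all points at which the
three functions are defined and `u`, `v` have no pole. -/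
def Relation (h : (Fin 5 → ℂ) → ℂ) (p q : Fin 5 → ℤ) (u v : RatFun ℚ) : Prop :=
  ∀ a ∈ domain 0 ∩ domain p ∩ domain q, RegularAt u a → RegularAt v a →
    h a = evalAt u a * h (a + intVec ℂ p) + evalAt v a * h (a + intVec ℂ q)

/-! ### Contiguous matrices and connection matrices -/

section Matrices

variable {K : Type*} [Field K]

/-- First elementary symmetric polynomial in `a₀, a₁, a₂`. -/
def phi1 (a : Fin 5 → K) : K := a 0 + a 1 + a 2

/-- Second elementary symmetric polynomial in `a₀, a₁, a₂`. -/
def phi2 (a : Fin 5 → K) : K := a 0 * a 1 + a 1 * a 2 + a 2 * a 0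

/-- Third elementary symmetric polynomial in `a₀, a₁, a₂`. -/
def phi3 (a : Fin 5 → K) : K := a 0 * a 1 * a 2

/-- `Aᵢ⁺(a)` for `{i, j, k} = {0, 1, 2}`. -/
def upperPlus (a : Fin 5 → K) (i j k : Fin 5) : Matrix (Fin 2) (Fin 2) K :=
  !![a i, 1;
     phi3 a / (saal a - 2),
       (a j * a k - (a i - a 3 + 1) * (a i - a 4 + 1)) / (saal a - 2)]

/-- `Aᵢ⁻(a)` for `{i, j, k} = {0, 1, 2}`. -/
def upperMinus (a : Fin 5 → K) (i j k : Fin 5) : Matrix (Fin 2) (Fin 2) K :=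
  !![((a i - a 3) * (a i - a 4) - a j * a k) / ((a i - 1) * (a i - a 3) * (a i - a 4)),
       (saal a - 1) / ((a i - 1) * (a i - a 3) * (a i - a 4));
     a j * a k / ((a i - a 3) * (a i - a 4)),
       -((saal a - 1) / ((a i - a 3) * (a i - a 4)))]

/-- `Aᵢ⁺(a)` for `i = 3, 4`. -/
def lowerPlus (a : Fin 5 → K) (i : Fin 5) : Matrix (Fin 2) (Fin 2) K :=
  !![(a i ^ 2 - phi1 a * a i + phi2 a) / ((a i - a 0) * (a i - a 1) * (a i - a 2)),
       -((saal a - 1) / ((a i - a 0) * (a i - a 1) * (a i - a 2)));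
     -(phi3 a / ((a i - a 0) * (a i - a 1) * (a i - a 2))),
       a i * (saal a - 1) / ((a i - a 0) * (a i - a 1) * (a i - a 2))]

/-- `Aᵢ⁻(a)` for `i = 3, 4`. -/
def lowerMinus (a : Fin 5 → K) (i : Fin 5) : Matrix (Fin 2) (Fin 2) K :=
  !![a i - 1, 1;
     phi3 a / (saal a - 2),
       ((a i - 1) ^ 2 - phi1 a * (a i - 1) + phi2 a) / (saal a - 2)]

/-- The contiguous matrix `Aᵢ^ε(a)`; the sign `ε = +` is `true`, `ε = -` is `false`. -/
def contigMatrix (a : Fin 5 → K) : Fin 5 → Bool → Matrix (Fin 2) (Fin 2) K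
  | 0, true => upperPlus a 0 1 2
  | 1, true => upperPlus a 1 0 2
  | 2, true => upperPlus a 2 0 1
  | 3, true => lowerPlus a 3
  | 4, true => lowerPlus a 4
  | 0, false => upperMinus a 0 1 2
  | 1, false => upperMinus a 1 0 2
  | 2, false => upperMinus a 2 0 1
  | 3, false => lowerMinus a 3
  | 4, false => lowerMinus a 4

/-- The lattice step `ε eᵢ`. -/
def step (d : Fin 5 × Bool) : Fin 5 → ℤ := Pi.single d.1 (if d.2 then 1 else -1)

/-- The end point `ε₁ e_{i₁} + ⋯ + ε_m e_{i_m}` of the lattice path from the origin with the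
given successive steps. -/
def endpoint (l : List (Fin 5 × Bool)) : Fin 5 → ℤ := (l.map step).sum

/-- The product of contiguous matrices
`A_{i_m}^{ε_m}(a + p_{m-1}) ⋯ A_{i_2}^{ε_2}(a + p_1) A_{i_1}^{ε_1}(a)`
along the lattice path with the given successive steps `ε_k e_{i_k} = p_k - p_{k-1}`. -/
def pathMatrix (a : Fin 5 → K) : List (Fin 5 × Bool) → Matrix (Fin 2) (Fin 2) K
  | [] => 1
  | d :: l => pathMatrix (a + intVec K (step d)) l * contigMatrix a d.1 d.2

/-- `(x, n) = Γ(x + n) / Γ(x)` for an integer `n`, as a rational function of `x`. -/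
def poch (x : K) : ℤ → K
  | Int.ofNat n => ∏ k ∈ Finset.range n, (x + k)
  | Int.negSucc m => (∏ k ∈ Finset.range (m + 1), (x - (k + 1)))⁻¹

/-- The closed form `δ(a; p)` of the determinant of the connection matrix. -/
def connDet (a : Fin 5 → K) (p : Fin 5 → ℤ) : K :=
  (-1) ^ (p 0 + p 1 + p 2) * poch (saal a - 1) (saal p) *
      (poch (a 0) (p 0) * poch (a 1) (p 1) * poch (a 2) (p 2)) /
    ((poch (a 3 - a 0) (p 3 - p 0) * poch (a 4 - a 0) (p 4 - p 0)) *
      (poch (a 3 - a 1) (p 3 - p 1) * poch (a 4 - a 1) (p 4 - p 1)) *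
      (poch (a 3 - a 2) (p 3 - p 2) * poch (a 4 - a 2) (p 4 - p 2)))

end Matrices

/-- The variables `a₀, …, a₄` as elements of `ℚ(a)`. -/
def vars : Fin 5 → RatFun ℚ := fun j =>
  algebraMap (MvPolynomial (Fin 5) ℚ) (RatFun ℚ) (MvPolynomial.X j)

/-- The pair `u`, `v` is produced by the recipe from the shift vectors `p`, `q`:

* any lattice path from the origin to `p` and any one to `q` give matrices `M`, `N` with top rows
  `(r₁(a;p), r(a;p))`, `(r₁(a;q), r(a;q))` such that `Δ = r₁(a;p) r(a;q) - r(a;p) r₁(a;q) ≠ 0`,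
  `u = r(a;q) / Δ` and `v = - r(a;p) / Δ`;
* alternatively, `Δ` is computed as `δ(a;p) r(a+p; q-p)`, with `r(a+p; q-p)` read off from the
  product along any lattice path from `p` to `q`. -/
def GivenByRecipe (p q : Fin 5 → ℤ) (u v : RatFun ℚ) : Prop :=
  ∀ lp lq : List (Fin 5 × Bool), endpoint lp = p → endpoint lq = q →
    (let M := pathMatrix vars lp
     let N := pathMatrix vars lq
     (M 0 0 * N 0 1 - M 0 1 * N 0 0 ≠ 0 ∧
      u = N 0 1 / (M 0 0 * N 0 1 - M 0 1 * N 0 0) ∧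
      v = -(M 0 1 / (M 0 0 * N 0 1 - M 0 1 * N 0 0))) ∧
     ∀ l : List (Fin 5 × Bool), endpoint l = q - p →
      let L := pathMatrix (vars + intVec (RatFun ℚ) p) l
      connDet vars p * L 0 1 ≠ 0 ∧
      u = N 0 1 / (connDet vars p * L 0 1) ∧
      v = -(M 0 1 / (connDet vars p * L 0 1)))

/-! ### The group of affine symmetries -/

theorem paramMap_add (ν : SingPt) (i : Fin 3) (x y : Fin 5 → ℂ) :
    paramMap ν i (x + y) = (paramMap ν i x - paramMap ν i 0) + paramMap ν i y := by
  cases ν <;> fin_cases i <;> ext j <;> fin_cases j <;> simp [paramMap] <;> ring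

theorem paramMap_smul (ν : SingPt) (i : Fin 3) (c : ℂ) (x : Fin 5 → ℂ) :
    paramMap ν i (c • x) - paramMap ν i 0 = c • (paramMap ν i x - paramMap ν i 0) := by
  cases ν <;> fin_cases i <;> ext j <;> fin_cases j <;> simp [paramMap] <;> ring

theorem paramMap_involutive (ν : SingPt) (i : Fin 3) :
    Function.Involutive (paramMap ν i : (Fin 5 → ℂ) → (Fin 5 → ℂ)) := by
  intro x
  cases ν <;> fin_cases i <;> ext j <;> fin_cases j <;> simp [paramMap] <;> ring

/-- The linear part `a ↦ σ(a) - σ(0)` of a parameter involution `σ`. -/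
def paramLin (ν : SingPt) (i : Fin 3) : (Fin 5 → ℂ) →ₗ[ℂ] (Fin 5 → ℂ) where
  toFun x := paramMap ν i x - paramMap ν i 0
  map_add' x y := by rw [paramMap_add]; abel
  map_smul' c x := paramMap_smul ν i c x

theorem paramLin_involutive (ν : SingPt) (i : Fin 3) :
    Function.Involutive (paramLin ν i) := by
  intro x
  change paramMap ν i (paramMap ν i x - paramMap ν i 0) - paramMap ν i 0 = x
  cases ν <;> fin_cases i <;> ext j <;> fin_cases j <;> simp [paramMap] <;> ring

/-- The parameter involutions as affine transformations of `ℂ⁵`. -/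
def paramAffine (ν : SingPt) (i : Fin 3) : (Fin 5 → ℂ) ≃ᵃ[ℂ] (Fin 5 → ℂ) where
  toEquiv := (paramMap_involutive ν i).toPerm
  linear := LinearEquiv.ofInvolutive (paramLin ν i) (paramLin_involutive ν i)
  map_vadd' a p := paramMap_add ν i p a

/-- The group `G` of affine transformations of `ℂ⁵` generated by the parameter involutions. -/
def symGroup : Subgroup ((Fin 5 → ℂ) ≃ᵃ[ℂ] (Fin 5 → ℂ)) :=
  Subgroup.closure {σ | ∃ ν i, σ = paramAffine ν i}

/-- The generators as elements of `G`. -/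
def gen (ν : SingPt) (i : Fin 3) : symGroup :=
  ⟨paramAffine ν i, Subgroup.subset_closure ⟨ν, i, rfl⟩⟩

/-- The group `S₂ ⋉ (S₃ × S₃)`, in which `S₂` permutes the two factors `S₃`. -/
abbrev S2S3S3 :=
  (Fin 2 → Equiv.Perm (Fin 3)) ⋊[mulAutArrow (G := Equiv.Perm (Fin 2)) (A := Fin 2)
    (M := Equiv.Perm (Fin 3))] Equiv.Perm (Fin 2)

/-- The symmetry `h(a) = χ^{s(p)} u(σ⁻¹ a) h(a + σ̄ p) + χ^{s(q)} v(σ⁻¹ a) h(a + σ̄ q)` of a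
three-term relation, where `σ̄` is the linear part of `σ` and `χ = ±1`. It includes that `σ̄ p`
and `σ̄ q` are integer vectors again. -/
def SymRelation (h : (Fin 5 → ℂ) → ℂ) (σ : (Fin 5 → ℂ) ≃ᵃ[ℂ] (Fin 5 → ℂ)) (χ : ℤˣ)
    (p q : Fin 5 → ℤ) (u v : RatFun ℚ) : Prop :=
  ∃ p' q' : Fin 5 → ℤ,
    σ.linear (intVec ℂ p) = intVec ℂ p' ∧ σ.linear (intVec ℂ q) = intVec ℂ q' ∧
    ∀ a ∈ domain 0 ∩ domain p' ∩ domain q',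
      RegularAt u (σ.symm a) → RegularAt v (σ.symm a) →
      h a = (((χ ^ saal p : ℤˣ) : ℤ) : ℂ) * evalAt u (σ.symm a) * h (a + intVec ℂ p') +
        (((χ ^ saal q : ℤˣ) : ℤ) : ℂ) * evalAt v (σ.symm a) * h (a + intVec ℂ q')

end ThreeTerm

end

/-
Up to a periodic factor, each companion function is `f` composed with an element of
`S₂ ⋉ (S₃ × S₃)`. This group acts on the parameters by permuting the nine differences of two
vectors in `ℂ³`, while the contiguous relations have the same shape at all six positions; hence
all six functions satisfy them, and every lattice path expresses `h(a + p)` through `h(a)` and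
`h(a + (1, …, 1))` with the same coefficients. Eliminating `h(a + (1, …, 1))` gives the relation
and the recipe, provided that the upper right entry `r(a; p)` is non-zero for `p ≠ 0`.

If `r(a; p)` were zero, `h(a + p)` would be a rational multiple of `h(a)` for each function `h` in
the orbit of `f`, and the orbit contains a function for which `p` is transformed into a vector with
`p₀ ≠ 0`. So everything reduces to the independence of `f(a)` and `f(a + p)` for `p₀ > 0`. In a
polynomial relation `A(a) F(a) + B(a) F(a + p) = 0` between the regularized series, `B` vanishes at
sufficiently many integral points on `a₀ = 0`, where `F(a) = 0 ≠ F(a + p)`, so `a₀` divides `B`;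
then it divides `A`, and infinite descent gives `A = B = 0`.

Identities are checked for large `Re s(a)` away from a meagre set. There the coordinates may be
taken algebraically independent over `ℚ`, so that rational functions can be evaluated by field
homomorphisms; analytic continuation in `a₃` extends the relation to the domain of convergence.
-/

open scoped BigOperators

noncomputable section

namespace ThreeTerm

open Filter Topology

/-! ### The regularized series -/

/-- The general term `(a₀)ₖ (a₁)ₖ (a₂)ₖ / (k! Γ(a₃+k) Γ(a₄+k))` of the regularized series. The
reciprocal Gamma function is written as an inverse, whose junk value `0` at the poles is correct, so
that every term is an entire function of `a`. -/
def regTerm (a : Fin 5 → ℂ) (k : ℕ) : ℂ :=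
  ((∏ j ∈ Finset.range k, (a 0 + j)) * (∏ j ∈ Finset.range k, (a 1 + j)) *
    (∏ j ∈ Finset.range k, (a 2 + j))) *
    ((Complex.Gamma (1 + k))⁻¹ * (Complex.Gamma (a 3 + k))⁻¹ * (Complex.Gamma (a 4 + k))⁻¹)

/-- The regularized series: `hgf a 1` without the factor `Γ(a₀) Γ(a₁) Γ(a₂)`, which is defined
and continuous also at integral parameters. -/
def regSum (a : Fin 5 → ℂ) : ℂ := ∑' k, regTerm a k

theorem regTerm_succ (a : Fin 5 → ℂ) (k : ℕ) :
    (k + 1) * ((a 3 + k) * (a 4 + k)) * regTerm a (k + 1) =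
      (a 0 + k) * (a 1 + k) * (a 2 + k) * regTerm a k := by
  have h1 := Complex.one_div_Gamma_eq_self_mul_one_div_Gamma_add_one (1 + k)
  have h3 := Complex.one_div_Gamma_eq_self_mul_one_div_Gamma_add_one (a 3 + k)
  have h4 := Complex.one_div_Gamma_eq_self_mul_one_div_Gamma_add_one (a 4 + k)
  simp only [regTerm, Finset.prod_range_succ, Nat.cast_add, Nat.cast_one, h1, h3, h4, ← add_assoc]
  ring

theorem norm_one_add_le_exp (z : ℂ) : ‖1 + z‖ ≤ Real.exp (z.re + ‖z‖ ^ 2 / 2) := by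
  refine le_of_sq_le_sq ?_ (Real.exp_pos _).le
  calc ‖1 + z‖ ^ 2 = 2 * z.re + ‖z‖ ^ 2 + 1 := by
        rw [Complex.sq_norm, Complex.sq_norm, Complex.normSq_apply, Complex.normSq_apply]
        simp only [Complex.add_re, Complex.one_re, Complex.add_im, Complex.one_im]
        ring
    _ ≤ Real.exp (2 * z.re + ‖z‖ ^ 2) := Real.add_one_le_exp _
    _ = Real.exp (z.re + ‖z‖ ^ 2 / 2) ^ 2 := by rw [← Real.exp_nat_mul]; congr 1; push_cast; ring

theorem exp_le_norm_one_add {z : ℂ} (hz : ‖z‖ ≤ 1 / 2) :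
    Real.exp (z.re - 4 * ‖z‖ ^ 2) ≤ ‖1 + z‖ := by
  have hlow : 1 / 2 ≤ ‖1 + z‖ := by
    have := norm_sub_norm_le (1 : ℂ) (-z)
    rw [norm_one, norm_neg, sub_neg_eq_add] at this
    linarith
  have hpos : 0 < ‖1 + z‖ := by linarith
  have hinv : ‖1 + z‖⁻¹ ≤ 2 := by simpa using inv_anti₀ (by norm_num) hlow
  have hne : 1 + z ≠ 0 := norm_pos_iff.mp hpos
  -- The upper bound is applied to `w = (1 + z)⁻¹ - 1 = -z + z² / (1 + z)`.
  have hw := norm_one_add_le_exp (-z / (1 + z))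
  have hw1 : 1 + -z / (1 + z) = (1 + z)⁻¹ := by field_simp; ring
  have hnorm : ‖-z / (1 + z)‖ ≤ 2 * ‖z‖ := by
    rw [norm_div, norm_neg, div_eq_mul_inv, mul_comm]
    gcongr
  have hre : (-z / (1 + z)).re ≤ -z.re + 2 * ‖z‖ ^ 2 := by
    have : -z / (1 + z) = -z + z ^ 2 / (1 + z) := by field_simp; ring
    rw [this, Complex.add_re, Complex.neg_re]
    have hle : ‖z ^ 2 / (1 + z)‖ ≤ 2 * ‖z‖ ^ 2 := by
      rw [norm_div, norm_pow, div_eq_mul_inv, mul_comm]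
      gcongr
    linarith [Complex.re_le_norm (z ^ 2 / (1 + z))]
  rw [hw1, norm_inv, inv_le_comm₀ hpos (Real.exp_pos _), ← Real.exp_neg] at hw
  refine (Real.exp_le_exp.2 ?_).trans hw
  nlinarith [norm_nonneg (-z / (1 + z)), norm_nonneg z]

theorem norm_one_add_prod_le {z : Fin 5 → ℂ} {δ : ℝ} (hδ : δ ≤ 1 / 2) (hz : ∀ i, ‖z i‖ ≤ δ) :
    ‖(1 + z 0) * (1 + z 1) * (1 + z 2)‖ ≤
      Real.exp (-(saal z).re + 10 * δ ^ 2) * ‖(1 + z 3) * (1 + z 4)‖ := by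
  have hup : ∀ i, ‖1 + z i‖ ≤ Real.exp ((z i).re + δ ^ 2 / 2) := fun i =>
    (norm_one_add_le_exp _).trans (Real.exp_le_exp.2 (by gcongr; exact hz i))
  have hlow : ∀ i, Real.exp ((z i).re - 4 * δ ^ 2) ≤ ‖1 + z i‖ := fun i =>
    (Real.exp_le_exp.2 (by gcongr; exact hz i)).trans (exp_le_norm_one_add ((hz i).trans hδ))
  have hsaal : (saal z).re = (z 3).re + (z 4).re - (z 0).re - (z 1).re - (z 2).re := by
    simp only [saal, Complex.sub_re, Complex.add_re]
  rw [norm_mul, norm_mul, norm_mul]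
  calc ‖1 + z 0‖ * ‖1 + z 1‖ * ‖1 + z 2‖
      ≤ Real.exp ((z 0).re + δ ^ 2 / 2) * Real.exp ((z 1).re + δ ^ 2 / 2) *
          Real.exp ((z 2).re + δ ^ 2 / 2) :=
        mul_le_mul (mul_le_mul (hup 0) (hup 1) (norm_nonneg _) (Real.exp_pos _).le) (hup 2)
          (norm_nonneg _) (by positivity)
    _ ≤ Real.exp (-(saal z).re + 10 * δ ^ 2) *
          (Real.exp ((z 3).re - 4 * δ ^ 2) * Real.exp ((z 4).re - 4 * δ ^ 2)) := by
        simp only [← Real.exp_add]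
        refine Real.exp_le_exp.2 ?_
        rw [hsaal]
        linarith [sq_nonneg δ]
    _ ≤ _ := mul_le_mul_of_nonneg_left
        (mul_le_mul (hlow 3) (hlow 4) (Real.exp_pos _).le (norm_nonneg _)) (Real.exp_pos _).le

theorem norm_regTerm_succ {a z : Fin 5 → ℂ} {k : ℕ} (h : ∀ i, a i + k = (k + 1) * (1 + z i)) :
    ‖(1 + z 3) * (1 + z 4)‖ * ‖regTerm a (k + 1)‖ =
      ‖(1 + z 0) * (1 + z 1) * (1 + z 2)‖ * ‖regTerm a k‖ := by
  rw [← norm_mul, ← norm_mul]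
  congr 1
  apply mul_left_cancel₀ (pow_ne_zero 3 (Nat.cast_add_one_ne_zero k : (k : ℂ) + 1 ≠ 0))
  have := regTerm_succ a k
  rw [h, h, h, h, h] at this
  linear_combination this

/-- As in Raabe's test, the ratio of consecutive terms is `1 - (1 + s(a)) / k + O(k⁻²)`. -/
theorem norm_regTerm_succ_le {C ε : ℝ} {a : Fin 5 → ℂ} {k : ℕ} (ha : ∀ i, ‖a i - 1‖ ≤ C)
    (hs : 2 * ε ≤ (saal a).re) (hk : 2 * C ≤ k + 1) (hkε : 10 * C ^ 2 ≤ ε * (k + 1)) :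
    ‖regTerm a (k + 1)‖ ≤ Real.exp (-((1 + ε) / (k + 1))) * ‖regTerm a k‖ := by
  obtain ⟨n, hn⟩ : ∃ n : ℝ, n = k + 1 := ⟨_, rfl⟩
  have hnk : (n : ℂ) = k + 1 := by rw [hn]; push_cast; rfl
  rw [← hn] at hk hkε ⊢
  have hn0 : 0 < n := by rw [hn]; positivity
  have hn0' : (n : ℂ) ≠ 0 := by exact_mod_cast hn0.ne'
  set z : Fin 5 → ℂ := fun i => (a i - 1) / n with hz
  have hzn : ∀ i, ‖z i‖ ≤ C / n := fun i => by
    rw [hz, norm_div, Complex.norm_real, Real.norm_of_nonneg hn0.le]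
    exact div_le_div_of_nonneg_right (ha i) hn0.le
  have hza : ∀ i, a i + k = (k + 1) * (1 + z i) := fun i => by
    rw [hz, ← hnk]
    field_simp
    linear_combination -hnk
  have hhalf : C / n ≤ 1 / 2 := by rw [div_le_div_iff₀ hn0 two_pos]; linarith
  have hpos : 0 < ‖(1 + z 3) * (1 + z 4)‖ := by
    have h (i) : 0 < ‖1 + z i‖ :=
      (Real.exp_pos _).trans_le (exp_le_norm_one_add ((hzn i).trans hhalf))
    rw [norm_mul]
    exact mul_pos (h 3) (h 4)
  have hexp : -(saal z).re + 10 * (C / n) ^ 2 ≤ -((1 + ε) / n) := by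
    have hsz : (saal z).re = (1 + (saal a).re) / n := by
      simp only [hz, saal, Complex.div_ofReal_re, Complex.sub_re, Complex.add_re, Complex.one_re]
      ring
    have hCn : 10 * (C / n) ^ 2 ≤ ε / n := by
      rw [div_pow, ← mul_div_assoc, div_le_div_iff₀ (by positivity) hn0]
      nlinarith
    calc _ ≤ -((1 + 2 * ε) / n) + ε / n := by rw [hsz]; gcongr
      _ = _ := by ring
  refine le_of_mul_le_mul_left ?_ hpos
  calc _ ≤ Real.exp (-((1 + ε) / n)) * ‖(1 + z 3) * (1 + z 4)‖ * ‖regTerm a k‖ := by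
        rw [norm_regTerm_succ hza]
        gcongr
        exact (norm_one_add_prod_le hhalf hzn).trans (by gcongr)
    _ = _ := by ring

theorem exp_neg_div_le_rpow {r : ℝ} (hr : 0 ≤ r) (k : ℕ) :
    Real.exp (-(r / (k + 1))) * ((k : ℝ) + 2) ^ r ≤ ((k : ℝ) + 1) ^ r := by
  have hk : (0 : ℝ) < k + 1 := by positivity
  have h : (k : ℝ) + 2 ≤ Real.exp (1 / (k + 1)) * (k + 1) := by
    have := mul_le_mul_of_nonneg_right (Real.add_one_le_exp (1 / ((k : ℝ) + 1))) hk.le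
    rw [add_mul, one_div_mul_cancel hk.ne'] at this
    linarith
  calc Real.exp (-(r / (k + 1))) * ((k : ℝ) + 2) ^ r
      ≤ Real.exp (-(r / (k + 1))) * (Real.exp (1 / (k + 1)) * (k + 1)) ^ r := by gcongr
    _ = ((k : ℝ) + 1) ^ r := by
        rw [Real.mul_rpow (Real.exp_pos _).le hk.le, ← Real.exp_mul, ← mul_assoc, ← Real.exp_add]
        ring_nf
        simp

theorem regTerm_decay (B : ℝ) {ε : ℝ} (hε : 0 < ε) :
    ∃ K : ℕ, ∀ a : Fin 5 → ℂ, ‖a‖ ≤ B → 2 * ε ≤ (saal a).re → ∀ k : ℕ, K ≤ k →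
      ‖regTerm a k‖ * ((k : ℝ) + 1) ^ (1 + ε) ≤ ‖regTerm a K‖ * ((K : ℝ) + 1) ^ (1 + ε) := by
  obtain ⟨K, hK⟩ := exists_nat_ge (max (2 * (B + 1)) (10 * (B + 1) ^ 2 / ε))
  refine ⟨K, fun a ha hs k hk => ?_⟩
  have hC : ∀ i, ‖a i - 1‖ ≤ B + 1 := fun i => by
    refine (norm_sub_le _ _).trans ?_
    rw [norm_one]
    linarith [norm_le_pi_norm a i]
  induction k, hk using Nat.le_induction with
  | base => rfl
  | succ k hk ih =>
    have hkK : (K : ℝ) ≤ k := by exact_mod_cast hk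
    have hk1 : 2 * (B + 1) ≤ k + 1 := by linarith [(le_max_left _ _).trans hK]
    have hk2 : 10 * (B + 1) ^ 2 ≤ ε * (k + 1) := by
      have := (div_le_iff₀ hε).1 ((le_max_right _ _).trans hK)
      nlinarith
    refine le_trans ?_ ih
    calc _ ≤ (Real.exp (-((1 + ε) / (k + 1))) * ‖regTerm a k‖) * ((k : ℝ) + 2) ^ (1 + ε) := by
          push_cast
          rw [add_assoc, one_add_one_eq_two]
          gcongr
          exact norm_regTerm_succ_le hC hs hk1 hk2
      _ = ‖regTerm a k‖ * (Real.exp (-((1 + ε) / (k + 1))) * ((k : ℝ) + 2) ^ (1 + ε)) := by ring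
      _ ≤ _ := by gcongr; exact exp_neg_div_le_rpow (by linarith) k

theorem continuous_regTerm (k : ℕ) : Continuous fun a : Fin 5 → ℂ => regTerm a k := by
  have h : Continuous fun x : ℂ => (Complex.Gamma x)⁻¹ :=
    Complex.differentiable_one_div_Gamma.continuous
  unfold regTerm
  refine Continuous.mul (by fun_prop) ?_
  refine Continuous.mul (continuous_const.mul ?_) ?_
  · exact h.comp (by fun_prop)
  · exact h.comp (by fun_prop)

theorem exists_summable_bound (B : ℝ) {ε : ℝ} (hε : 0 < ε) :
    ∃ u : ℕ → ℝ, Summable u ∧ ∀ (k : ℕ) (a : Fin 5 → ℂ), ‖a‖ ≤ B → ε ≤ (saal a).re →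
      ‖regTerm a k‖ ≤ u k := by
  obtain ⟨K, hK⟩ := regTerm_decay B (half_pos hε)
  have hc : ∀ k, ∃ C, ∀ a ∈ Metric.closedBall (0 : Fin 5 → ℂ) B, ‖regTerm a k‖ ≤ C := fun k =>
    (isCompact_closedBall 0 B).exists_bound_of_continuousOn (continuous_regTerm k).continuousOn
  choose C hC using hc
  refine ⟨fun k => if k < K then C k else
    C K * ((K : ℝ) + 1) ^ (1 + ε / 2) * (1 / ((k : ℝ) + 1) ^ (1 + ε / 2)), ?_, fun k a ha hs => ?_⟩
  · have h := (((summable_nat_add_iff 1).2 ((Real.summable_one_div_nat_rpow (p := 1 + ε / 2)).2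
      (by linarith))).mul_left (C K * ((K : ℝ) + 1) ^ (1 + ε / 2)))
    refine (summable_congr_cofinite ?_).2 h
    rw [Nat.cofinite_eq_atTop]
    filter_upwards [eventually_ge_atTop K] with k hk
    rw [if_neg (by omega), Nat.cast_succ]
  · have ha' : a ∈ Metric.closedBall (0 : Fin 5 → ℂ) B := by simpa using ha
    dsimp only
    split_ifs with hk
    · exact hC k a ha'
    · rw [mul_one_div, le_div_iff₀ (by positivity)]
      exact (hK a ha (by linarith) k (by omega)).trans
        (mul_le_mul_of_nonneg_right (hC K a ha') (by positivity))

theorem summable_norm_regTerm {a : Fin 5 → ℂ} (ha : 0 < (saal a).re) :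
    Summable fun k => ‖regTerm a k‖ := by
  obtain ⟨u, hu, h⟩ := exists_summable_bound ‖a‖ ha
  exact hu.of_nonneg_of_le (fun _ => norm_nonneg _) fun k => h k a le_rfl le_rfl

theorem summable_regTerm {a : Fin 5 → ℂ} (ha : 0 < (saal a).re) : Summable (regTerm a) :=
  (summable_norm_regTerm ha).of_norm

theorem continuous_saal_re : Continuous fun a : Fin 5 → ℂ => (saal a).re := by
  unfold saal
  fun_prop

theorem isOpen_ball_inter (B ε : ℝ) : IsOpen {a : Fin 5 → ℂ | ‖a‖ < B ∧ ε < (saal a).re} :=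
  (isOpen_lt continuous_norm continuous_const).inter (isOpen_lt continuous_const continuous_saal_re)

theorem continuousAt_regSum {a : Fin 5 → ℂ} (ha : 0 < (saal a).re) : ContinuousAt regSum a := by
  obtain ⟨u, hu, h⟩ := exists_summable_bound (‖a‖ + 1) (half_pos ha)
  have hc : ContinuousOn regSum {x | ‖x‖ < ‖a‖ + 1 ∧ (saal a).re / 2 < (saal x).re} :=
    continuousOn_tsum (fun k => (continuous_regTerm k).continuousOn) hu
      fun k x hx => h k x hx.1.le hx.2.le
  exact hc.continuousAt ((isOpen_ball_inter _ _).mem_nhds ⟨by linarith, by linarith⟩)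

/-- The shift of the parameter `a₃` by a complex number. -/
def shiftThree (a : Fin 5 → ℂ) (t : ℂ) : Fin 5 → ℂ := fun j => a j + if j = 3 then t else 0

theorem saal_shiftThree (a : Fin 5 → ℂ) (t : ℂ) : saal (shiftThree a t) = saal a + t := by
  simp [saal, shiftThree]
  ring

theorem continuous_shiftThree (a : Fin 5 → ℂ) : Continuous (shiftThree a) := by
  refine continuous_pi fun j => ?_
  unfold shiftThree
  by_cases hj : j = 3 <;> simp only [hj, if_true, if_false] <;> fun_prop

theorem differentiable_regTerm_shiftThree (a : Fin 5 → ℂ) (k : ℕ) :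
    Differentiable ℂ fun t => regTerm (shiftThree a t) k := by
  have h : Differentiable ℂ fun t => (Complex.Gamma (a 3 + t + k))⁻¹ :=
    Complex.differentiable_one_div_Gamma.comp (g := fun x : ℂ => (Complex.Gamma x)⁻¹)
      (f := fun t => a 3 + t + k) (by fun_prop)
  have he : (fun t => regTerm (shiftThree a t) k) = fun t =>
      ((∏ j ∈ Finset.range k, (a 0 + j)) * (∏ j ∈ Finset.range k, (a 1 + j)) *
      (∏ j ∈ Finset.range k, (a 2 + j))) *
      ((Complex.Gamma (1 + k))⁻¹ * (Complex.Gamma (a 3 + t + k))⁻¹ *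
        (Complex.Gamma (a 4 + k))⁻¹) := by
    funext t
    simp [regTerm, shiftThree]
  rw [he]
  exact ((h.const_mul _).mul_const _).const_mul _

theorem differentiableOn_regSum_shiftThree (a : Fin 5 → ℂ) :
    DifferentiableOn ℂ (fun t => regSum (shiftThree a t)) {t | 0 < (saal a).re + t.re} := by
  intro t ht
  simp only [Set.mem_ofPred_eq] at ht
  obtain ⟨u, hu, h⟩ := exists_summable_bound (‖shiftThree a t‖ + 1) (half_pos ht)
  set U := {x : ℂ | ‖shiftThree a x‖ < ‖shiftThree a t‖ + 1 ∧
    ((saal a).re + t.re) / 2 < (saal (shiftThree a x)).re}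
  have hUo : IsOpen U := (isOpen_ball_inter _ _).preimage (continuous_shiftThree a)
  have hd : DifferentiableOn ℂ (fun t => regSum (shiftThree a t)) U :=
    Complex.differentiableOn_tsum_of_summable_norm hu
      (fun k => (differentiable_regTerm_shiftThree a k).differentiableOn) hUo
      fun k x hx => h k _ hx.1.le hx.2.le
  refine (hd.differentiableAt (hUo.mem_nhds ⟨by linarith, ?_⟩)).differentiableWithinAt
  rw [saal_shiftThree, Complex.add_re]
  linarith

theorem Gamma_add_natCast (x : ℂ) (hx : ∀ n : ℤ, x ≠ n) (k : ℕ) :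
    Complex.Gamma (x + k) = (∏ j ∈ Finset.range k, (x + j)) * Complex.Gamma x := by
  induction k with
  | zero => simp
  | succ k ih =>
    have h : x + k ≠ 0 := fun h => hx (-k) (by push_cast; linear_combination h)
    rw [Finset.prod_range_succ, Nat.cast_succ, ← add_assoc, Complex.Gamma_add_one _ h, ih]
    ring

theorem hgf_term_eq {a : Fin 5 → ℂ} (h0 : ∀ n : ℤ, a 0 ≠ n) (h1 : ∀ n : ℤ, a 1 ≠ n)
    (h2 : ∀ n : ℤ, a 2 ≠ n) (k : ℕ) :
    Complex.Gamma (a 0 + k) * Complex.Gamma (a 1 + k) * Complex.Gamma (a 2 + k) /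
    (Complex.Gamma (1 + k) * Complex.Gamma (a 3 + k) * Complex.Gamma (a 4 + k)) * 1 ^ k =
      Complex.Gamma (a 0) * Complex.Gamma (a 1) * Complex.Gamma (a 2) * regTerm a k := by
  rw [Gamma_add_natCast _ h0, Gamma_add_natCast _ h1, Gamma_add_natCast _ h2, regTerm,
    div_eq_mul_inv, mul_inv, mul_inv, one_pow]
  ring

theorem hgf_one_eq {a : Fin 5 → ℂ} (h0 : ∀ n : ℤ, a 0 ≠ n) (h1 : ∀ n : ℤ, a 1 ≠ n)
    (h2 : ∀ n : ℤ, a 2 ≠ n) :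
    hgf a 1 = Complex.Gamma (a 0) * Complex.Gamma (a 1) * Complex.Gamma (a 2) * regSum a := by
  rw [hgf, regSum, ← tsum_mul_left]
  exact tsum_congr (hgf_term_eq h0 h1 h2)

theorem continuousAt_hgf_one {a : Fin 5 → ℂ} (ha : ∀ i < 3, ∀ n : ℤ, a i ≠ n)
    (hs : 0 < (saal a).re) : ContinuousAt (fun x => hgf x 1) a := by
  have hne : ∀ i < 3, ∀ᶠ x : Fin 5 → ℂ in 𝓝 a, ∀ n : ℤ, x i ≠ n := fun i hi => by
    have hopen : IsOpen (Set.range ((↑) : ℤ → ℂ))ᶜ :=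
      Complex.isClosedEmbedding_intCast.isClosed_range.isOpen_compl
    filter_upwards [(continuous_apply i).continuousAt (hopen.mem_nhds (x := a i) (by
      rintro ⟨n, hn⟩
      exact ha i hi n hn.symm))] with x hx n hn using hx ⟨n, hn.symm⟩
  have hGamma : ∀ i < 3, ContinuousAt (fun x : Fin 5 → ℂ => Complex.Gamma (x i)) a := fun i hi =>
    ContinuousAt.comp (g := Complex.Gamma) (f := fun x : Fin 5 → ℂ => x i)
      (Complex.differentiableAt_Gamma _ fun m => by exact_mod_cast ha i hi (-m)).continuousAt
      (continuous_apply i).continuousAt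
  refine ((((hGamma 0 (by decide)).mul (hGamma 1 (by decide))).mul (hGamma 2 (by decide))).mul
    (continuousAt_regSum hs)).congr ?_
  filter_upwards [hne 0 (by decide), hne 1 (by decide), hne 2 (by decide)] with x h0 h1 h2
  exact (hgf_one_eq h0 h1 h2).symm

/-! ### Generic points -/

section Generic

variable {K : Type*} [Field K]

theorem saal_add (a b : Fin 5 → K) : saal (a + b) = saal a + saal b := by
  simp only [saal, Pi.add_apply]
  ring

theorem saal_intVec (p : Fin 5 → ℤ) : saal (intVec K p) = (saal p : ℤ) := by
  simp [saal, intVec]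

theorem intVec_add (p q : Fin 5 → ℤ) : intVec K (p + q) = intVec K p + intVec K q := by
  ext j
  simp [intVec]

theorem intVec_one : intVec K (1 : Fin 5 → ℤ) = 1 := by
  ext j
  simp [intVec]

/-- A stronger form of genericity over an arbitrary field, under which no denominator of a
contiguous matrix vanishes: no entry, no difference of two entries and no value of `s` is an
integer. -/
structure NonInt (a : Fin 5 → K) : Prop where
  entry : ∀ i, ∀ n : ℤ, a i ≠ n
  diff : ∀ i j, i ≠ j → ∀ n : ℤ, a i - a j ≠ n
  saal : ∀ n : ℤ, saal a ≠ n

theorem NonInt.add_intVec {a : Fin 5 → K} (ha : NonInt a) (p : Fin 5 → ℤ) :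
    NonInt (a + intVec K p) := by
  refine ⟨fun i n h => ha.entry i (n - p i) ?_,
    fun i j hij n h => ha.diff i j hij (n - p i + p j) ?_,
    fun n h => ha.saal (n - ThreeTerm.saal p) ?_⟩
  · simp only [Pi.add_apply, intVec] at h
    push_cast
    linear_combination h
  · simp only [Pi.add_apply, intVec] at h
    push_cast
    linear_combination h
  · rw [saal_add, saal_intVec] at h
    push_cast
    linear_combination h

theorem NonInt.map {L : Type*} [Field L] {a : Fin 5 → K} (ha : NonInt a) (φ : K →+* L) :
    NonInt (φ ∘ a) := by
  refine ⟨fun i n h => ha.entry i n (φ.injective ?_),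
    fun i j hij n h => ha.diff i j hij n (φ.injective ?_), fun n h => ha.saal n (φ.injective ?_)⟩
  · simpa using h
  · simpa using h
  · simpa [ThreeTerm.saal] using h

theorem NonInt.generic {a : Fin 5 → ℂ} (ha : NonInt a) : Generic a := ⟨ha.entry, ha.diff⟩

theorem Generic.add_intVec {a : Fin 5 → ℂ} (ha : Generic a) (p : Fin 5 → ℤ) :
    Generic (a + intVec ℂ p) := by
  refine ⟨fun i n h => ha.1 i (n - p i) ?_, fun i j hij n h => ha.2 i j hij (n - p i + p j) ?_⟩
  · simp only [Pi.add_apply, intVec] at h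
    push_cast
    linear_combination h
  · simp only [Pi.add_apply, intVec] at h
    push_cast
    linear_combination h

theorem algebraMap_ne_of_eval_ne {P : MvPolynomial (Fin 5) ℚ} {n : ℤ} {x : Fin 5 → ℚ}
    (h : MvPolynomial.eval x P ≠ n) : algebraMap (MvPolynomial (Fin 5) ℚ) (RatFun ℚ) P ≠ n := by
  rintro hP
  rw [← map_intCast (algebraMap (MvPolynomial (Fin 5) ℚ) (RatFun ℚ))] at hP
  refine h ?_
  rw [IsFractionRing.injective (MvPolynomial (Fin 5) ℚ) (RatFun ℚ) hP, map_intCast]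

theorem nonInt_vars : NonInt vars := by
  refine ⟨fun i n => ?_, fun i j hij n => ?_, fun n => ?_⟩
  · exact algebraMap_ne_of_eval_ne (x := fun _ => n + 1) (by simp)
  · rw [vars, vars, ← map_sub]
    exact algebraMap_ne_of_eval_ne (x := Pi.single i (n + 1)) (by simp [hij.symm])
  · simp only [saal, vars, ← map_add, ← map_sub]
    exact algebraMap_ne_of_eval_ne (x := Pi.single 3 (n + 1)) (by simp)

end Generic

/-! ### Evaluation of rational functions -/

theorem isOpen_eval_ne_zero (P : MvPolynomial (Fin 5) ℂ) :
    IsOpen {a : Fin 5 → ℂ | MvPolynomial.eval a P ≠ 0} :=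
  isOpen_ne.preimage (MvPolynomial.continuous_eval P)

theorem dense_eval_ne_zero {P : MvPolynomial (Fin 5) ℂ} (hP : P ≠ 0) :
    Dense {a : Fin 5 → ℂ | MvPolynomial.eval a P ≠ 0} := by
  rw [dense_iff_inter_open]
  rintro U hU ⟨a, ha⟩
  by_contra hcon
  obtain ⟨ε, hε, hball⟩ := Metric.isOpen_iff.1 hU a ha
  refine hP (MvPolynomial.funext_set (fun i => Metric.ball (a i) ε) (fun i => ?_) fun x hx => ?_)
  · exact infinite_of_mem_nhds (a i) (Metric.ball_mem_nhds _ hε)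
  · rw [map_zero]
    by_contra h
    refine hcon ⟨x, hball ?_, h⟩
    rw [ball_pi _ hε]
    exact hx

theorem eventually_residual_eval_ne_zero {P : MvPolynomial (Fin 5) ℂ} (hP : P ≠ 0) :
    ∀ᶠ a in residual (Fin 5 → ℂ), MvPolynomial.eval a P ≠ 0 :=
  residual_of_dense_open (isOpen_eval_ne_zero P) (dense_eval_ne_zero hP)

section Values

variable {K : Type*} [Field K] [Algebra K ℂ]

theorem aeval_eq_eval_map (a : Fin 5 → ℂ) (P : MvPolynomial (Fin 5) K) :
    MvPolynomial.aeval a P = MvPolynomial.eval a (MvPolynomial.map (algebraMap K ℂ) P) := by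
  rw [MvPolynomial.aeval_def, MvPolynomial.eval_map]

theorem map_ne_zero_of_ne_zero {P : MvPolynomial (Fin 5) K} (hP : P ≠ 0) :
    MvPolynomial.map (algebraMap K ℂ) P ≠ 0 := fun h =>
  hP (MvPolynomial.map_injective _ (algebraMap K ℂ).injective (by rw [h, map_zero]))

theorem eventually_residual_aeval_ne_zero {P : MvPolynomial (Fin 5) K} (hP : P ≠ 0) :
    ∀ᶠ a in residual (Fin 5 → ℂ), MvPolynomial.aeval a P ≠ 0 := by
  simpa only [aeval_eq_eval_map] using
    eventually_residual_eval_ne_zero (map_ne_zero_of_ne_zero hP)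

theorem eventually_residual_regularAt (u : RatFun K) :
    ∀ᶠ a in residual (Fin 5 → ℂ), RegularAt u a :=
  eventually_residual_aeval_ne_zero (nonZeroDivisors.ne_zero (SetLike.coe_mem _))

end Values

theorem eventually_residual_algebraicIndependent :
    ∀ᶠ a in residual (Fin 5 → ℂ), AlgebraicIndependent ℚ a := by
  have : Countable (MvPolynomial (Fin 5) ℚ) := by
    rw [← Cardinal.mk_le_aleph0_iff]
    exact MvPolynomial.cardinalMk_le_max.trans (by simp)
  have h : ∀ᶠ a in residual (Fin 5 → ℂ), ∀ P : MvPolynomial (Fin 5) ℚ, P ≠ 0 →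
      MvPolynomial.aeval a P ≠ 0 := by
    rw [eventually_countable_forall]
    intro P
    by_cases hP : P = 0
    · simp [hP]
    · filter_upwards [eventually_residual_aeval_ne_zero hP] with a ha _ using ha
  filter_upwards [h] with a ha
  rw [algebraicIndependent_iff]
  exact fun P hP => by_contra fun hne => ha P hne hP

/-- Evaluation at a point with algebraically independent coordinates, as an embedding of fields;
all computations in `ℚ(a)` are carried out at such points. -/
def evalHom {a : Fin 5 → ℂ} (ha : AlgebraicIndependent ℚ a) : RatFun ℚ →+* ℂ :=
  IsFractionRing.lift (A := MvPolynomial (Fin 5) ℚ) (K := RatFun ℚ)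
    (g := (MvPolynomial.aeval a : MvPolynomial (Fin 5) ℚ →ₐ[ℚ] ℂ).toRingHom) ha

theorem evalHom_vars {a : Fin 5 → ℂ} (ha : AlgebraicIndependent ℚ a) : evalHom ha ∘ vars = a := by
  ext j
  simp [evalHom, vars]

theorem evalAt_eq_evalHom {a : Fin 5 → ℂ} (ha : AlgebraicIndependent ℚ a) (u : RatFun ℚ) :
    evalAt u a = evalHom ha u := by
  conv_rhs => rw [← IsFractionRing.mk'_num_den (MvPolynomial (Fin 5) ℚ) u]
  exact (IsFractionRing.lift_mk' (A := MvPolynomial (Fin 5) ℚ) (K := RatFun ℚ)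
    (g := (MvPolynomial.aeval a : MvPolynomial (Fin 5) ℚ →ₐ[ℚ] ℂ).toRingHom) ha _ _).symm

theorem nonInt_of_algebraicIndependent {a : Fin 5 → ℂ} (ha : AlgebraicIndependent ℚ a) :
    NonInt a := evalHom_vars ha ▸ nonInt_vars.map (evalHom ha)

/-! ### Rational functions on a half space -/

/-- The filter of comeagre subsets of half spaces `Re s(a) > M` with `M → ∞`. Identities which hold
eventually along this filter hold at sufficiently generic points at which finitely many given
translates of the series converge. -/
def far : Filter (Fin 5 → ℂ) := comap (fun a => (saal a).re) atTop ⊓ residual (Fin 5 → ℂ)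

theorem eventually_far {P : (Fin 5 → ℂ) → Prop} :
    (∀ᶠ a in far, P a) ↔ ∃ M : ℝ, ∀ᶠ a in residual (Fin 5 → ℂ), M < (saal a).re → P a := by
  simp only [far, Filter.Eventually, true_and, Prod.exists,
    ((atTop_basis_Ioi.comap _).inf (residual _).basis_sets).mem_iff]
  constructor
  · rintro ⟨M, S, hS, h⟩
    exact ⟨M, mem_of_superset hS fun a ha hM => h ⟨hM, ha⟩⟩
  · rintro ⟨M, h⟩
    exact ⟨M, _, h, fun a ha => ha.2 ha.1⟩

theorem far_le_residual : far ≤ residual (Fin 5 → ℂ) := inf_le_right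

theorem eventually_lt_saal (M : ℝ) : ∀ᶠ a in far, M < (saal a).re :=
  eventually_far.2 ⟨M, Eventually.of_forall fun _ h => h⟩

theorem eventually_far_algebraicIndependent : ∀ᶠ a in far, AlgebraicIndependent ℚ a :=
  eventually_residual_algebraicIndependent.filter_mono far_le_residual

theorem eventually_far_nonInt : ∀ᶠ a in far, NonInt a :=
  eventually_far_algebraicIndependent.mono fun _ => nonInt_of_algebraicIndependent

theorem eventually_mem_domain (p : Fin 5 → ℤ) : ∀ᶠ a in far, a ∈ domain p := by
  filter_upwards [eventually_far_nonInt, eventually_lt_saal (-(saal p : ℤ))] with a ha hs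
  refine ⟨ha.generic, ?_⟩
  rw [saal_add, saal_intVec, Complex.add_re, Complex.intCast_re]
  linarith

theorem eq_zero_of_continuousAt {g : (Fin 5 → ℂ) → ℂ} {a : Fin 5 → ℂ} {M : ℝ}
    (hg : ContinuousAt g a) (ha : M < (saal a).re)
    (h : ∀ᶠ x in residual (Fin 5 → ℂ), M < (saal x).re → g x = 0) : g a = 0 := by
  by_contra hne
  have hnhds : ∀ᶠ x in 𝓝 a, M < (saal x).re ∧ g x ≠ 0 :=
    (continuous_saal_re.continuousAt.eventually_const_lt ha).and (hg.eventually_ne hne)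
  obtain ⟨x, hx, hM, hgx⟩ :=
    ((mem_closure_iff_frequently.1 (dense_of_mem_residual h a)).and_eventually hnhds).exists
  exact hgx (hx hM)

instance far_neBot : far.NeBot := by
  refine ⟨fun hbot => ?_⟩
  obtain ⟨M, h⟩ := eventually_far.1 (hbot ▸ eventually_bot : ∀ᶠ _ in far, False)
  have := eq_zero_of_continuousAt (g := fun _ => 1) (a := ![0, 0, 0, ((M + 1 : ℝ) : ℂ), 0])
    continuousAt_const (M := M) (by simp [saal]) (h.mono fun x hx hM => (hx hM).elim)
  exact one_ne_zero this

theorem tendsto_far (σ : (Fin 5 → ℂ) ≃ᵃ[ℂ] (Fin 5 → ℂ)) {c : ℂ}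
    (h : ∀ a, saal (σ a) = saal a + c) : Tendsto σ far far := by
  intro S hS
  obtain ⟨M, hM⟩ := eventually_far.1 (show ∀ᶠ a in far, a ∈ S from hS)
  have hσ : Tendsto σ (residual (Fin 5 → ℂ)) (residual (Fin 5 → ℂ)) :=
    tendsto_residual_of_isOpenMap σ.toContinuousAffineEquiv.continuous
      σ.toContinuousAffineEquiv.toHomeomorph.isOpenMap
  refine eventually_far.2 ⟨M - c.re, (hσ.eventually hM).mono fun a ha hs => ha ?_⟩
  rw [h, Complex.add_re]
  linarith

/-- The translation by an integer vector as an affine equivalence. -/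
def translation (p : Fin 5 → ℤ) : (Fin 5 → ℂ) ≃ᵃ[ℂ] (Fin 5 → ℂ) :=
  AffineEquiv.constVAdd ℂ (Fin 5 → ℂ) (intVec ℂ p)

theorem translation_apply (p : Fin 5 → ℤ) (a : Fin 5 → ℂ) :
    translation p a = a + intVec ℂ p := add_comm _ _

theorem tendsto_translation (p : Fin 5 → ℤ) : Tendsto (fun a => a + intVec ℂ p) far far := by
  simpa only [← translation_apply] using
    tendsto_far (translation p) fun a => by rw [translation_apply, saal_add]

theorem eval_bind₁ (Q : Fin 5 → MvPolynomial (Fin 5) ℂ) (P : MvPolynomial (Fin 5) ℂ)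
    (a : Fin 5 → ℂ) : MvPolynomial.eval a (MvPolynomial.bind₁ Q P) =
      MvPolynomial.eval (fun j => MvPolynomial.eval a (Q j)) P := by
  simp only [MvPolynomial.eval, MvPolynomial.eval₂Hom_bind₁]

theorem exists_eval_comp (σ : (Fin 5 → ℂ) ≃ᵃ[ℂ] (Fin 5 → ℂ)) (P : MvPolynomial (Fin 5) ℂ) :
    ∃ P' : MvPolynomial (Fin 5) ℂ,
      ∀ a, MvPolynomial.eval a P' = MvPolynomial.eval (σ a) P := by
  refine ⟨MvPolynomial.bind₁ (fun j => MvPolynomial.C (σ 0 j) +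
    ∑ i, MvPolynomial.C (σ.linear (Pi.single i 1) j) * MvPolynomial.X i) P, fun a => ?_⟩
  rw [eval_bind₁]
  congr 2
  funext j
  have hσ : σ a = σ.linear a + σ 0 := by simpa using σ.map_vadd 0 a
  have hlin : σ.linear a = ∑ i, a i • σ.linear (Pi.single i 1) := by
    conv_lhs => rw [pi_eq_sum_univ' a]
    simp only [map_sum, map_smul]
  rw [hσ, hlin]
  simp [add_comm, mul_comm]

theorem eventually_eq_zero_of_mul_eval {φ : (Fin 5 → ℂ) → ℂ} {Q : MvPolynomial (Fin 5) ℂ}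
    (hQ : Q ≠ 0) (h : ∀ᶠ a in far, φ a * MvPolynomial.eval a Q = 0) : ∀ᶠ a in far, φ a = 0 := by
  filter_upwards [h, (eventually_residual_eval_ne_zero hQ).filter_mono far_le_residual]
    with a ha hQa using (mul_eq_zero.1 ha).resolve_right hQa

/-- The function agrees eventually with a rational function over `ℂ`. -/
def IsRat (φ : (Fin 5 → ℂ) → ℂ) : Prop :=
  ∃ P Q : MvPolynomial (Fin 5) ℂ, Q ≠ 0 ∧
    ∀ᶠ a in far, φ a * MvPolynomial.eval a Q = MvPolynomial.eval a P

namespace IsRat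

variable {φ ψ : (Fin 5 → ℂ) → ℂ}

theorem eval (P : MvPolynomial (Fin 5) ℂ) : IsRat fun a => MvPolynomial.eval a P :=
  ⟨P, 1, one_ne_zero, by simp⟩

theorem const (c : ℂ) : IsRat fun _ => c := by simpa using eval (MvPolynomial.C c)

theorem coord (i : Fin 5) : IsRat fun a => a i := by simpa using eval (MvPolynomial.X i)

theorem add (hφ : IsRat φ) (hψ : IsRat ψ) : IsRat fun a => φ a + ψ a := by
  obtain ⟨P, Q, hQ, h⟩ := hφ
  obtain ⟨P', Q', hQ', h'⟩ := hψ
  refine ⟨P * Q' + P' * Q, Q * Q', mul_ne_zero hQ hQ', ?_⟩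
  filter_upwards [h, h'] with a ha ha'
  simp only [map_add, map_mul, ← ha, ← ha']
  ring

theorem mul (hφ : IsRat φ) (hψ : IsRat ψ) : IsRat fun a => φ a * ψ a := by
  obtain ⟨P, Q, hQ, h⟩ := hφ
  obtain ⟨P', Q', hQ', h'⟩ := hψ
  refine ⟨P * P', Q * Q', mul_ne_zero hQ hQ', ?_⟩
  filter_upwards [h, h'] with a ha ha'
  simp only [map_mul, ← ha, ← ha']
  ring

theorem neg (hφ : IsRat φ) : IsRat fun a => -φ a := by simpa using (const (-1)).mul hφ

theorem sub (hφ : IsRat φ) (hψ : IsRat ψ) : IsRat fun a => φ a - ψ a := by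
  simpa only [sub_eq_add_neg] using hφ.add hψ.neg

theorem eventually_eq_zero_or (hφ : IsRat φ) : (∀ᶠ a in far, φ a = 0) ∨ ∀ᶠ a in far, φ a ≠ 0 := by
  obtain ⟨P, Q, hQ, h⟩ := hφ
  by_cases hP : P = 0
  · exact .inl (eventually_eq_zero_of_mul_eval hQ (by simpa only [hP, map_zero] using h))
  · right
    filter_upwards [h, (eventually_residual_eval_ne_zero hP).filter_mono far_le_residual]
      with a ha hPa hφ
    rw [hφ, zero_mul] at ha
    exact hPa ha.symm

theorem inv (hφ : IsRat φ) : IsRat fun a => (φ a)⁻¹ := by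
  rcases hφ.eventually_eq_zero_or with h0 | h0
  · exact ⟨0, 1, one_ne_zero, by filter_upwards [h0] with a ha; simp [ha]⟩
  · obtain ⟨P, Q, hQ, h⟩ := hφ
    refine ⟨Q, P, ?_, ?_⟩
    · rintro rfl
      obtain ⟨a, ha, ha0, hQa⟩ :=
        (h.and (h0.and ((eventually_residual_eval_ne_zero hQ).filter_mono far_le_residual))).exists
      exact mul_ne_zero ha0 hQa (by rw [ha, map_zero])
    · filter_upwards [h, h0] with a ha ha0
      rw [← ha, inv_mul_cancel_left₀ ha0]

theorem div (hφ : IsRat φ) (hψ : IsRat ψ) : IsRat fun a => φ a / ψ a := by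
  simpa only [div_eq_mul_inv] using hφ.mul hψ.inv

theorem comp_affineEquiv (hφ : IsRat φ) (σ : (Fin 5 → ℂ) ≃ᵃ[ℂ] (Fin 5 → ℂ)) {c : ℂ}
    (hσ : ∀ a, saal (σ a) = saal a + c) : IsRat fun a => φ (σ a) := by
  obtain ⟨P, Q, hQ, h⟩ := hφ
  obtain ⟨P', hP'⟩ := exists_eval_comp σ P
  obtain ⟨Q', hQ'⟩ := exists_eval_comp σ Q
  refine ⟨P', Q', ?_, ?_⟩
  · rintro rfl
    refine hQ (MvPolynomial.funext fun x => ?_)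
    simpa using (hQ' (σ.symm x)).symm
  · filter_upwards [(tendsto_far σ hσ).eventually h] with a ha
    rw [hP', hQ', ha]

theorem evalAt {K : Type*} [Field K] [Algebra K ℂ] (u : RatFun K) : IsRat (evalAt u) := by
  simp only [funext fun a => ThreeTerm.evalAt.eq_1 u a, aeval_eq_eval_map]
  exact (eval _).div (eval _)

end IsRat

theorem eq_zero_of_eventually_evalAt {K : Type*} [Field K] [Algebra K ℂ] {u : RatFun K}
    (h : ∀ᶠ a in far, evalAt u a = 0) : u = 0 := by
  by_contra hu
  have hnum : IsFractionRing.num (MvPolynomial (Fin 5) K) u ≠ 0 := fun h0 => hu (by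
    rw [← IsFractionRing.mk'_num_den (MvPolynomial (Fin 5) K) u, h0, IsLocalization.mk'_zero])
  obtain ⟨a, ha, hnum_a, hreg⟩ := (h.and ((eventually_residual_aeval_ne_zero hnum).and
    (eventually_residual_regularAt u)|>.filter_mono far_le_residual)).exists
  exact div_ne_zero hnum_a hreg ha

theorem eq_of_eventually_evalHom {u v : RatFun ℚ}
    (h : ∀ᶠ a in far, ∀ ha : AlgebraicIndependent ℚ a, evalHom ha u = evalHom ha v) : u = v := by
  obtain ⟨a, ha, hind⟩ := (h.and eventually_far_algebraicIndependent).exists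
  exact (evalHom hind).injective (ha hind)

/-! ### Determinants of the contiguous matrices -/

section FieldMatrices

variable {K : Type*} [Field K]

theorem endpoint_cons (d : Fin 5 × Bool) (l : List (Fin 5 × Bool)) :
    endpoint (d :: l) = step d + endpoint l := by
  simp [endpoint]

theorem endpoint_append (l l' : List (Fin 5 × Bool)) :
    endpoint (l ++ l') = endpoint l + endpoint l' := by
  simp [endpoint]

theorem add_intVec_step (a : Fin 5 → K) (d : Fin 5 × Bool) (l : List (Fin 5 × Bool)) :
    a + intVec K (step d) + intVec K (endpoint l) = a + intVec K (endpoint (d :: l)) := by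
  rw [endpoint_cons, intVec_add, add_assoc]

theorem pathMatrix_append (a : Fin 5 → K) (l l' : List (Fin 5 × Bool)) :
    pathMatrix a (l ++ l') = pathMatrix (a + intVec K (endpoint l)) l' * pathMatrix a l := by
  induction l generalizing a with
  | nil =>
    have : a + intVec K 0 = a := by ext j; simp [intVec]
    simp [pathMatrix, endpoint, this]
  | cons d l ih =>
    rw [List.cons_append, pathMatrix, ih, add_intVec_step, pathMatrix, Matrix.mul_assoc]

theorem map_contigMatrix {L : Type*} [Field L] (φ : K →+* L) (a : Fin 5 → K) (d : Fin 5 × Bool) :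
    (contigMatrix a d.1 d.2).map φ = contigMatrix (φ ∘ a) d.1 d.2 := by
  obtain ⟨i, b⟩ := d
  ext r c
  fin_cases i <;> cases b <;> fin_cases r <;> fin_cases c <;>
    simp [contigMatrix, upperPlus, upperMinus, lowerPlus, lowerMinus, phi1, phi2, phi3, saal,
      map_ofNat φ 2]

theorem map_pathMatrix {L : Type*} [Field L] (φ : K →+* L) (a : Fin 5 → K)
    (l : List (Fin 5 × Bool)) : (pathMatrix a l).map φ = pathMatrix (φ ∘ a) l := by
  induction l generalizing a with
  | nil => simp [pathMatrix]
  | cons d l ih =>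
    have hφ : φ ∘ (a + intVec K (step d)) = φ ∘ a + intVec L (step d) := by
      ext j
      simp [intVec]
    rw [pathMatrix, Matrix.map_mul, ih, map_contigMatrix, hφ, pathMatrix]

theorem poch_add_one {x : K} (hx : ∀ n : ℤ, x ≠ n) (n : ℤ) :
    poch x (n + 1) = poch x n * (x + n) := by
  obtain ⟨n, rfl | rfl⟩ := n.eq_nat_or_neg
  · change poch x (Int.ofNat (n + 1)) = poch x (Int.ofNat n) * _
    rw [poch, poch, Finset.prod_range_succ]
    simp
  · cases n with
    | zero =>
      change poch x (Int.ofNat 1) = poch x (Int.ofNat 0) * _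
      simp [poch]
    | succ m =>
      have hne : x - (m + 1) ≠ 0 := fun h => hx (m + 1) (by push_cast; linear_combination h)
      change poch x (Int.negSucc m + 1) = poch x (Int.negSucc m) * _
      have hr : poch x (Int.negSucc m) * (x + ((-((m + 1 : ℕ) : ℤ) : ℤ) : K)) =
          (∏ k ∈ Finset.range m, (x - (k + 1)))⁻¹ := by
        rw [poch, Finset.prod_range_succ, mul_inv]
        push_cast
        rw [← sub_eq_add_neg, mul_assoc, inv_mul_cancel₀ hne, mul_one]
      rw [hr]
      cases m with
      | zero =>
        change poch x (Int.ofNat 0) = _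
        simp [poch]
      | succ m => rfl

theorem poch_add {x : K} (hx : ∀ n : ℤ, x ≠ n) (m n : ℤ) :
    poch x (m + n) = poch x m * poch (x + m) n := by
  have hxm : ∀ n : ℤ, x + m ≠ n := fun n h => hx (n - m) (by push_cast; linear_combination h)
  induction n using Int.induction_on with
  | zero =>
    change _ = _ * poch (x + m) (Int.ofNat 0)
    simp [poch]
  | succ n ih =>
    rw [← add_assoc, poch_add_one hx, ih, poch_add_one hxm]
    push_cast
    ring
  | pred n ih =>
    have h1 := poch_add_one hx (m + (-n - 1))
    have h2 := poch_add_one hxm (-n - 1)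
    rw [show m + (-n - 1 : ℤ) + 1 = m + -n by ring, ih] at h1
    rw [show (-n - 1 : ℤ) + 1 = -n by ring] at h2
    rw [h2] at h1
    have hne : x + m + ((-n - 1 : ℤ) : K) ≠ 0 := fun h => hxm (n + 1) (by
      push_cast at h ⊢
      linear_combination h)
    refine mul_right_cancel₀ hne ?_
    push_cast at h1 ⊢
    linear_combination -h1

theorem poch_zero (x : K) : poch x 0 = 1 := by
  change poch x (Int.ofNat 0) = 1
  simp [poch]

theorem poch_one (x : K) : poch x 1 = x := by
  change poch x (Int.ofNat 1) = x
  simp [poch]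

theorem poch_neg_one (x : K) : poch x (-1) = (x - 1)⁻¹ := by
  change poch x (Int.negSucc 0) = _
  simp [poch]

theorem NonInt.connDet_add {a : Fin 5 → K} (ha : NonInt a) (p q : Fin 5 → ℤ) :
    connDet a (p + q) = connDet a p * connDet (a + intVec K p) q := by
  have hs : ∀ n : ℤ, ThreeTerm.saal a - 1 ≠ n := fun n h =>
    ha.saal (n + 1) (by push_cast; linear_combination h)
  have h1 : ∀ i, poch (a i) ((p + q) i) = poch (a i) (p i) * poch ((a + intVec K p) i) (q i) :=
    fun i => poch_add (ha.entry i) _ _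
  have h2 : ∀ i j, i ≠ j → poch (a i - a j) ((p + q) i - (p + q) j) =
      poch (a i - a j) (p i - p j) *
        poch ((a + intVec K p) i - (a + intVec K p) j) (q i - q j) := fun i j hij => by
    rw [show (p + q) i - (p + q) j = (p i - p j) + (q i - q j) by simp; ring,
      poch_add (ha.diff i j hij)]
    congr 2
    simp [intVec]
    ring
  have h3 : poch (ThreeTerm.saal a - 1) (ThreeTerm.saal (p + q)) =
      poch (ThreeTerm.saal a - 1) (ThreeTerm.saal p) *
        poch (ThreeTerm.saal (a + intVec K p) - 1) (ThreeTerm.saal q) := by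
    rw [show ThreeTerm.saal (p + q) = ThreeTerm.saal p + ThreeTerm.saal q by
      simp only [ThreeTerm.saal, Pi.add_apply]
      ring, poch_add hs, saal_add, saal_intVec]
    congr 2
    ring
  have h4 : (-1 : K) ^ ((p + q) 0 + (p + q) 1 + (p + q) 2) =
      (-1) ^ (p 0 + p 1 + p 2) * (-1) ^ (q 0 + q 1 + q 2) := by
    rw [← zpow_add₀ (by norm_num)]
    congr 1
    simp
    ring
  rw [connDet, connDet, connDet, div_mul_div_comm, h1, h1, h1, h2 3 0 (by decide),
    h2 4 0 (by decide), h2 3 1 (by decide), h2 4 1 (by decide), h2 3 2 (by decide),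
    h2 4 2 (by decide), h3, h4]
  congr 1 <;> ring

theorem connDet_zero (a : Fin 5 → K) : connDet a 0 = 1 := by
  simp [connDet, saal, poch_zero]

theorem NonInt.connDet_ne_zero {a : Fin 5 → K} (ha : NonInt a) (p : Fin 5 → ℤ) :
    connDet a p ≠ 0 := by
  have h := ha.connDet_add p (-p)
  rw [add_neg_cancel, connDet_zero] at h
  exact left_ne_zero_of_mul (h ▸ one_ne_zero)

theorem NonInt.sub_one_ne_zero {a : Fin 5 → K} (ha : NonInt a) (i : Fin 5) : a i - 1 ≠ 0 :=
  sub_ne_zero.2 (by simpa using ha.entry i 1)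

theorem NonInt.sub_ne_zero {a : Fin 5 → K} (ha : NonInt a) {i j : Fin 5} (hij : i ≠ j) :
    a i - a j ≠ 0 := by simpa using ha.diff i j hij 0

theorem NonInt.saal_sub_ne_zero {a : Fin 5 → K} (ha : NonInt a) (n : ℤ) :
    ThreeTerm.saal a - n ≠ 0 := _root_.sub_ne_zero.2 (ha.saal n)

theorem NonInt.det_contigMatrix {a : Fin 5 → K} (ha : NonInt a) (d : Fin 5 × Bool) :
    (contigMatrix a d.1 d.2).det = connDet a (step d) := by
  have hs : a 3 + a 4 - a 0 - a 1 - a 2 - 2 ≠ 0 := by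
    simpa [ThreeTerm.saal] using ha.saal_sub_ne_zero 2
  have hs' : a 3 + a 4 - a 0 - a 1 - a 2 - 1 - 1 ≠ 0 := fun h => hs (by linear_combination h)
  obtain ⟨i, b⟩ := d
  rw [Matrix.det_fin_two]
  fin_cases i <;> cases b <;>
    simp [contigMatrix, upperPlus, upperMinus, lowerPlus, lowerMinus, phi1, phi2, phi3, connDet,
      step, ThreeTerm.saal, poch_zero, poch_one, poch_neg_one] <;>
    field_simp (disch := first
      | assumption
      | exact ha.sub_one_ne_zero _
      | exact ha.sub_ne_zero (by decide)) <;>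
    ring

theorem NonInt.det_pathMatrix {a : Fin 5 → K} (ha : NonInt a) (l : List (Fin 5 × Bool)) :
    (pathMatrix a l).det = connDet a (endpoint l) := by
  induction l generalizing a with
  | nil => simp [pathMatrix, endpoint, connDet_zero]
  | cons d l ih =>
    rw [pathMatrix, Matrix.det_mul, ih (ha.add_intVec _), ha.det_contigMatrix, endpoint_cons,
      ha.connDet_add, mul_comm]

end FieldMatrices

theorem evalAt_pathMatrix {a : Fin 5 → ℂ} (ha : AlgebraicIndependent ℚ a)
    (l : List (Fin 5 × Bool)) (i j : Fin 2) :
    evalAt (pathMatrix vars l i j) a = pathMatrix a l i j := by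
  rw [evalAt_eq_evalHom ha, ← Matrix.map_apply (f := evalHom ha), map_pathMatrix, evalHom_vars]

theorem isRat_pathMatrix (l : List (Fin 5 × Bool)) (i j : Fin 2) :
    IsRat fun a => pathMatrix a l i j := by
  obtain ⟨P, Q, hQ, h⟩ := IsRat.evalAt (pathMatrix vars l i j)
  refine ⟨P, Q, hQ, ?_⟩
  filter_upwards [h, eventually_far_algebraicIndependent] with a ha hind
  rw [← ha, evalAt_pathMatrix hind]

/-! ### The action of `S₂ ⋉ (S₃ × S₃)` -/

section Action

/-- The place of each parameter in the pair of triples `(a₀, a₁, a₂)`, `(1, a₃, a₄)`; the place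
`(1, 0)` is the one of the entry `1`. -/
def place : Fin 5 → Fin 2 × Fin 3 := ![(0, 0), (0, 1), (0, 2), (1, 1), (1, 2)]

theorem place_injective : Function.Injective place := by decide

theorem place_ne (k : Fin 5) : place k ≠ (1, 0) := by revert k; decide

theorem eq_or_exists_eq_place (y : Fin 2 × Fin 3) : y = (1, 0) ∨ ∃ k, y = place k := by
  revert y; decide

/-- The permutation of the six places given by an element of `S₂ ⋉ (S₃ × S₃)`. -/
def placePerm (x : S2S3S3) : Equiv.Perm (Fin 2 × Fin 3) where
  toFun y := (x.right y.1, x.left (x.right y.1) y.2)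
  invFun y := (x.right⁻¹ y.1, (x.left y.1)⁻¹ y.2)
  left_inv y := by simp
  right_inv y := by simp

theorem placePerm_symm_apply (x : S2S3S3) (y : Fin 2 × Fin 3) :
    (placePerm x).symm y = (x.right⁻¹ y.1, (x.left y.1)⁻¹ y.2) := rfl

theorem placePerm_one : placePerm 1 = 1 := rfl

theorem placePerm_mul (x y : S2S3S3) : placePerm (x * y) = placePerm x * placePerm y := by
  refine Equiv.ext fun z => Prod.ext rfl ?_
  change x.left _ (y.left (x.right⁻¹ (x.right (y.right z.1))) z.2) = _
  rw [← Equiv.Perm.mul_apply x.right⁻¹, inv_mul_cancel]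
  rfl

/-- The sign `χ` of the `S₂`-component. -/
def sgn (x : S2S3S3) : ℤˣ := Equiv.Perm.sign x.right

theorem sgn_one : sgn 1 = 1 := by simp [sgn]

theorem sgn_mul (x y : S2S3S3) : sgn (x * y) = sgn x * sgn y := by simp [sgn]

/-- The sign of a place: `1` in the upper triple, `-1` in the lower one. -/
def placeSign (y : Fin 2 × Fin 3) : ℤˣ := if y.1 = 0 then 1 else -1

theorem placeSign_placePerm (x : S2S3S3) (y : Fin 2 × Fin 3) :
    placeSign (placePerm x y) = sgn x * placeSign y := by
  have h : ∀ (g : Equiv.Perm (Fin 2)) (i : Fin 2),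
      (if g i = 0 then 1 else -1 : ℤˣ) = Equiv.Perm.sign g * if i = 0 then 1 else -1 := by decide
  exact h x.right y.1

/-- The parameters as a pair of triples, with lower triple `(c, a₃, a₄)`; here `c = 1` for points
and `c = 0` for shift vectors. -/
def triples {R : Type*} (c : R) (a : Fin 5 → R) (y : Fin 2 × Fin 3) : R :=
  ![![a 0, a 1, a 2], ![c, a 3, a 4]] y.1 y.2

theorem triples_place {R : Type*} (c : R) (a : Fin 5 → R) (k : Fin 5) :
    triples c a (place k) = a k := by
  fin_cases k <;> rfl

theorem triples_one_zero {R : Type*} (c : R) (a : Fin 5 → R) : triples c a (1, 0) = c := rfl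

variable {R : Type*} [CommRing R]

/-- The inverse of `triples c`, on pairs of triples modulo simultaneous translation. -/
def ofTriples (c : R) (w : Fin 2 × Fin 3 → R) : Fin 5 → R :=
  fun k => w (place k) + (c - w (1, 0))

theorem triples_ofTriples (c : R) (w : Fin 2 × Fin 3 → R) (y : Fin 2 × Fin 3) :
    triples c (ofTriples c w) y = w y + (c - w (1, 0)) := by
  obtain rfl | ⟨k, rfl⟩ := eq_or_exists_eq_place y
  · rw [triples_one_zero]
    ring
  · rw [triples_place, ofTriples]

theorem ext_triples_sub (c : R) {a b : Fin 5 → R}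
    (h : ∀ y z, triples c a y - triples c a z = triples c b y - triples c b z) : a = b := by
  ext k
  have hk := h (place k) (1, 0)
  rwa [triples_place, triples_place, triples_one_zero, triples_one_zero, sub_left_inj] at hk

/-- The action on points (`c = 1`) and its linear part (`c = 0`): the six entries are permuted,
multiplied by the sign, and translated so that the entry at the place `(1, 0)` is again `c`. -/
def act (c : R) (x : S2S3S3) (a : Fin 5 → R) : Fin 5 → R :=
  ofTriples c fun y => ((sgn x : ℤ) : R) * triples c a ((placePerm x).symm y)

theorem triples_act_sub (c : R) (x : S2S3S3) (a : Fin 5 → R) (y z : Fin 2 × Fin 3) :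
    triples c (act c x a) (placePerm x y) - triples c (act c x a) (placePerm x z) =
      ((sgn x : ℤ) : R) * (triples c a y - triples c a z) := by
  simp only [act, triples_ofTriples, Equiv.symm_apply_apply]
  ring

theorem eq_act (c : R) (x : S2S3S3) {a b : Fin 5 → R}
    (h : ∀ y z, triples c b (placePerm x y) - triples c b (placePerm x z) =
      ((sgn x : ℤ) : R) * (triples c a y - triples c a z)) : b = act c x a := by
  refine ext_triples_sub c fun y z => ?_
  obtain ⟨y, rfl⟩ := (placePerm x).surjective y
  obtain ⟨z, rfl⟩ := (placePerm x).surjective z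
  rw [h, triples_act_sub]

theorem act_one (c : R) (a : Fin 5 → R) : act c 1 a = a :=
  (eq_act c 1 fun y z => by simp [placePerm_one, sgn_one]).symm

theorem act_mul (c : R) (x y : S2S3S3) (a : Fin 5 → R) :
    act c (x * y) a = act c x (act c y a) := by
  refine (eq_act c (x * y) fun z z' => ?_).symm
  rw [placePerm_mul, Equiv.Perm.mul_apply, Equiv.Perm.mul_apply, triples_act_sub, triples_act_sub,
    sgn_mul]
  push_cast
  ring

theorem act_inv_act (c : R) (x : S2S3S3) (a : Fin 5 → R) : act c x⁻¹ (act c x a) = a := by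
  rw [← act_mul, inv_mul_cancel, act_one]

theorem act_act_inv (c : R) (x : S2S3S3) (a : Fin 5 → R) : act c x (act c x⁻¹ a) = a := by
  rw [← act_mul, mul_inv_cancel, act_one]

theorem triples_add (c d : R) (a b : Fin 5 → R) (y : Fin 2 × Fin 3) :
    triples (c + d) (a + b) y = triples c a y + triples d b y := by
  obtain rfl | ⟨k, rfl⟩ := eq_or_exists_eq_place y
  · simp only [triples_one_zero]
  · simp only [triples_place, Pi.add_apply]

theorem act_add (c d : R) (x : S2S3S3) (a b : Fin 5 → R) :
    act (c + d) x (a + b) = act c x a + act d x b := by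
  refine (eq_act _ x fun y z => ?_).symm
  simp only [triples_add]
  linear_combination triples_act_sub c x a y z + triples_act_sub d x b y z

theorem triples_intVec (c : ℤ) (p : Fin 5 → ℤ) (y : Fin 2 × Fin 3) :
    triples (c : R) (intVec R p) y = (triples c p y : ℤ) := by
  obtain rfl | ⟨k, rfl⟩ := eq_or_exists_eq_place y
  · simp only [triples_one_zero]
  · simp only [triples_place, intVec]

theorem act_intVec (c : ℤ) (x : S2S3S3) (p : Fin 5 → ℤ) :
    act (c : R) x (intVec R p) = intVec R (act c x p) := by
  refine (eq_act _ x fun y z => ?_).symm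
  simp only [triples_intVec]
  exact_mod_cast congrArg (Int.cast : ℤ → R) (triples_act_sub c x p y z)

theorem act_add_intVec (x : S2S3S3) (a : Fin 5 → R) (p : Fin 5 → ℤ) :
    act 1 x (a + intVec R p) = act 1 x a + intVec R (act 0 x p) := by
  simpa using (act_add 1 0 x a (intVec R p)).trans (by rw [← act_intVec, Int.cast_zero])

theorem act_zero_zero (x : S2S3S3) : act (0 : R) x 0 = 0 := by
  simpa using act_add (0 : R) 0 x 0 0

theorem saal_eq_sum (c : R) (a : Fin 5 → R) :
    saal a = -∑ y, ((placeSign y : ℤ) : R) * triples c a y - c := by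
  simp [Fintype.sum_prod_type, Fin.sum_univ_three, triples, saal, placeSign]
  ring

theorem sum_placeSign : ∑ y, ((placeSign y : ℤ) : R) = 0 := by
  exact_mod_cast congrArg (Int.cast : ℤ → R) (by decide : ∑ y, (placeSign y : ℤ) = 0)

theorem sgn_mul_self (x : S2S3S3) : ((sgn x : ℤ) : R) * (sgn x : ℤ) = 1 := by
  exact_mod_cast congrArg (Int.cast : ℤ → R) (Int.units_coe_mul_self (sgn x))

theorem saal_act (c : R) (x : S2S3S3) (a : Fin 5 → R) : saal (act c x a) = saal a := by
  set d := c - ((sgn x : ℤ) : R) * triples c a ((placePerm x).symm (1, 0)) with hd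
  have hsum : ∑ y, ((placeSign y : ℤ) : R) * triples c (act c x a) y =
      ∑ y, ((placeSign y : ℤ) : R) * triples c a y := by
    calc ∑ y, ((placeSign y : ℤ) : R) * triples c (act c x a) y
        = ∑ y, ((placeSign (placePerm x y) : ℤ) : R) *
            triples c (act c x a) (placePerm x y) := (Equiv.sum_comp (placePerm x) _).symm
      _ = ∑ y, (((placeSign y : ℤ) : R) * triples c a y +
            (sgn x : ℤ) * d * (placeSign y : ℤ)) := Finset.sum_congr rfl fun y _ => by
          rw [act, triples_ofTriples, Equiv.symm_apply_apply, placeSign_placePerm, ← hd]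
          push_cast
          linear_combination (placeSign y : ℤ) * triples c a y * sgn_mul_self (R := R) x
      _ = _ := by rw [Finset.sum_add_distrib, ← Finset.mul_sum, sum_placeSign, mul_zero, add_zero]
  rw [saal_eq_sum c, hsum, ← saal_eq_sum]

end Action

theorem triples_one_sub_ne {a : Fin 5 → ℂ} (ha : Generic a) {y z : Fin 2 × Fin 3} (hyz : y ≠ z)
    (n : ℤ) : triples 1 a y - triples 1 a z ≠ n := by
  intro h
  obtain rfl | ⟨k, rfl⟩ := eq_or_exists_eq_place y <;>
    obtain rfl | ⟨l, rfl⟩ := eq_or_exists_eq_place z <;>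
    simp only [triples_one_zero, triples_place] at h
  · exact hyz rfl
  · exact ha.1 l (1 - n) (by push_cast; linear_combination -h)
  · exact ha.1 k (1 + n) (by push_cast; linear_combination h)
  · exact ha.2 k l (fun hkl => hyz (hkl ▸ rfl)) n h

theorem Generic.act {a : Fin 5 → ℂ} (ha : Generic a) (x : S2S3S3) : Generic (act 1 x a) := by
  have key : ∀ y z, y ≠ z → ∀ n : ℤ,
      triples 1 (ThreeTerm.act 1 x a) y - triples 1 (ThreeTerm.act 1 x a) z ≠ n := by
    intro y z hyz n h
    obtain ⟨y, rfl⟩ := (placePerm x).surjective y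
    obtain ⟨z, rfl⟩ := (placePerm x).surjective z
    rw [triples_act_sub] at h
    refine triples_one_sub_ne ha (fun hyz' => hyz (congrArg _ hyz')) (sgn x * n) ?_
    push_cast
    rw [← h, ← mul_assoc, sgn_mul_self, one_mul]
  refine ⟨fun k n h => key _ _ (place_ne k) (n - 1) ?_,
    fun k l hkl n h => key _ _ (place_injective.ne hkl) n ?_⟩
  · rw [triples_place, triples_one_zero, h]
    push_cast
    rfl
  · rw [triples_place, triples_place, h]

theorem eq_one_of_act_eq {x : S2S3S3}
    (h : act 1 x ![0, 2, 5, 3, 10] = (![0, 2, 5, 3, 10] : Fin 5 → ℤ)) : x = 1 := by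
  revert x
  have key : ∀ f g, act 1 (⟨f, g⟩ : S2S3S3) ![0, 2, 5, 3, 10] = (![0, 2, 5, 3, 10] : Fin 5 → ℤ) →
      f = 1 ∧ g = 1 := by decide +kernel
  exact fun {x} h => SemidirectProduct.ext (key _ _ h).1 (key _ _ h).2

/-- The permutation representation of `S₂ ⋉ (S₃ × S₃)` on the parameter space. -/
def actPerm : S2S3S3 →* Equiv.Perm (Fin 5 → ℂ) :=
  MonoidHom.toHomPerm
    { toFun := fun x => act 1 x
      map_one' := funext fun a => act_one 1 a
      map_mul' := fun x y => funext fun a => act_mul 1 x y a }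

theorem actPerm_apply (x : S2S3S3) (a : Fin 5 → ℂ) : actPerm x a = act 1 x a := rfl

theorem actPerm_injective : Function.Injective actPerm := by
  rw [injective_iff_map_eq_one]
  refine fun x hx => eq_one_of_act_eq ?_
  have h : act ((1 : ℤ) : ℂ) x (intVec ℂ ![0, 2, 5, 3, 10]) = intVec ℂ ![0, 2, 5, 3, 10] := by
    rw [Int.cast_one, ← actPerm_apply, hx, Equiv.Perm.one_apply]
  rw [act_intVec] at h
  exact funext fun j => Int.cast_injective (congrFun h j)

/-- The elements of `S₂ ⋉ (S₃ × S₃)` which act as the parameter involutions. -/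
def genElt : SingPt → Fin 3 → S2S3S3
  | .zero, i => SemidirectProduct.inl (Pi.mulSingle (1 : Fin 2) (Equiv.swap (0 : Fin 3) i))
  | .infty, i => ⟨fun _ => Equiv.swap 0 i, Equiv.swap 0 1⟩

theorem act_genElt (ν : SingPt) (i : Fin 3) (a : Fin 5 → ℂ) :
    act 1 (genElt ν i) a = paramMap ν i a := by
  ext k
  cases ν <;> fin_cases i <;> fin_cases k <;>
    simp [genElt, act, ofTriples, place, placePerm_symm_apply, sgn, triples, paramMap,
      Equiv.swap_apply_def] <;>
    ring

theorem genElt_infty_zero : genElt .infty 0 = SemidirectProduct.inr (Equiv.swap 0 1) := by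
  refine SemidirectProduct.ext ?_ rfl
  funext i
  simp [genElt]
  rfl

theorem closure_swap_eq_top :
    Subgroup.closure {Equiv.swap (0 : Fin 3) 1, Equiv.swap 0 2} = ⊤ := by
  rw [eq_top_iff]
  rintro π -
  have hswap : ∀ i, Equiv.swap (0 : Fin 3) i ∈
      Subgroup.closure {Equiv.swap (0 : Fin 3) 1, Equiv.swap 0 2} := by
    intro i
    fin_cases i
    · exact Equiv.swap_self (0 : Fin 3) ▸ one_mem _
    · exact Subgroup.subset_closure (by simp)
    · exact Subgroup.subset_closure (by simp)
  obtain ⟨i, j, k, rfl⟩ : ∃ i j k : Fin 3, π = .swap 0 i * .swap 0 j * .swap 0 k := by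
    revert π; decide
  exact mul_mem (mul_mem (hswap i) (hswap j)) (hswap k)

theorem inr_swap_conj_inl (π : Equiv.Perm (Fin 3)) :
    (SemidirectProduct.inr (Equiv.swap 0 1) * SemidirectProduct.inl (Pi.mulSingle 1 π) *
      SemidirectProduct.inr (Equiv.swap 0 1)⁻¹ : S2S3S3) =
      SemidirectProduct.inl (Pi.mulSingle 0 π) := by
  rw [← SemidirectProduct.inl_aut]
  congr 1
  funext i
  change (Pi.mulSingle (1 : Fin 2) π : Fin 2 → Equiv.Perm (Fin 3)) ((Equiv.swap 0 1)⁻¹ i) = _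
  fin_cases i <;> simp

theorem closure_genElt_eq_top :
    Subgroup.closure {genElt .infty 0, genElt .zero 1, genElt .zero 2} = ⊤ := by
  set H := Subgroup.closure {genElt .infty 0, genElt .zero 1, genElt .zero 2}
  have hswap : SemidirectProduct.inr (Equiv.swap 0 1) ∈ H :=
    genElt_infty_zero ▸ Subgroup.subset_closure (by simp)
  have hlower : ∀ π, SemidirectProduct.inl (Pi.mulSingle 1 π) ∈ H := by
    let F : Equiv.Perm (Fin 3) →* S2S3S3 := SemidirectProduct.inl.comp
      (MonoidHom.mulSingle (fun _ : Fin 2 => Equiv.Perm (Fin 3)) 1)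
    have hF : ⊤ ≤ H.comap F := by
      rw [← closure_swap_eq_top, Subgroup.closure_le]
      rintro _ (rfl | rfl)
      · exact Subgroup.subset_closure (by simp [genElt, F])
      · exact Subgroup.subset_closure (by simp [genElt, F])
    exact fun π => hF (Subgroup.mem_top π)
  have hupper : ∀ π, SemidirectProduct.inl (Pi.mulSingle 0 π) ∈ H := fun π => by
    rw [← inr_swap_conj_inl, map_inv]
    exact mul_mem (mul_mem hswap (hlower π)) (inv_mem hswap)
  rw [eq_top_iff]
  rintro ⟨f, g⟩ -
  have hf : f = Pi.mulSingle 0 (f 0) * Pi.mulSingle 1 (f 1) := by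
    funext i
    fin_cases i <;> simp
  have hg : g = 1 ∨ g = Equiv.swap 0 1 := by revert g; decide
  rw [SemidirectProduct.mk_eq_inl_mul_inr, hf, map_mul]
  refine mul_mem (mul_mem (hupper _) (hlower _)) ?_
  rcases hg with rfl | rfl
  · rw [map_one]
    exact one_mem H
  · exact hswap

/-- The affine transformations in `G` as permutations of the parameter space. -/
def symPerm : symGroup →* Equiv.Perm (Fin 5 → ℂ) where
  toFun σ := σ.1.toEquiv
  map_one' := rfl
  map_mul' _ _ := rfl

theorem symPerm_injective : Function.Injective symPerm := fun _ _ h =>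
  Subtype.ext (AffineEquiv.toEquiv_injective h)

theorem symPerm_gen (ν : SingPt) (i : Fin 3) : symPerm (gen ν i) = actPerm (genElt ν i) := by
  ext1 a
  exact (act_genElt ν i a).symm

theorem range_symPerm : symPerm.range = actPerm.range := by
  apply le_antisymm
  · rintro _ ⟨⟨σ, hσ⟩, rfl⟩
    induction hσ using Subgroup.closure_induction with
    | mem σ h =>
      obtain ⟨ν, i, rfl⟩ := h
      exact ⟨genElt ν i, (symPerm_gen ν i).symm⟩
    | one => exact one_mem _
    | mul _ _ _ _ h1 h2 => exact mul_mem h1 h2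
    | inv _ _ h1 => exact inv_mem h1
  · rw [MonoidHom.range_eq_map, ← closure_genElt_eq_top, Subgroup.map_le_iff_le_comap,
      Subgroup.closure_le]
    rintro x (rfl | rfl | rfl) <;> exact ⟨_, symPerm_gen _ _⟩

/-- The isomorphism of the symmetry group `G` with `S₂ ⋉ (S₃ × S₃)`. -/
def symEquiv : symGroup ≃* S2S3S3 :=
  (MonoidHom.ofInjective symPerm_injective).trans
    ((MulEquiv.subgroupCongr range_symPerm).trans (MonoidHom.ofInjective actPerm_injective).symm)

theorem actPerm_symEquiv (σ : symGroup) : actPerm (symEquiv σ) = symPerm σ :=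
  MonoidHom.apply_ofInjective_symm actPerm_injective
    (MulEquiv.subgroupCongr range_symPerm (MonoidHom.ofInjective symPerm_injective σ))

theorem symEquiv_gen (ν : SingPt) (i : Fin 3) : symEquiv (gen ν i) = genElt ν i :=
  actPerm_injective (by rw [actPerm_symEquiv, symPerm_gen])

theorem symGroup_apply (σ : symGroup) (a : Fin 5 → ℂ) : σ.1 a = act 1 (symEquiv σ) a := by
  rw [← actPerm_apply, actPerm_symEquiv]
  rfl

theorem symGroup_symm_apply (σ : symGroup) (a : Fin 5 → ℂ) :
    σ.1.symm a = act 1 (symEquiv σ)⁻¹ a := by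
  rw [← σ.1.injective.eq_iff, AffineEquiv.apply_symm_apply, symGroup_apply, act_act_inv]

theorem symGroup_linear_intVec (σ : symGroup) (p : Fin 5 → ℤ) :
    σ.1.linear (intVec ℂ p) = intVec ℂ (act 0 (symEquiv σ) p) := by
  have h := σ.1.map_vadd 0 (intVec ℂ p)
  rw [symGroup_apply, symGroup_apply, vadd_eq_add, vadd_eq_add, add_comm, act_add_intVec,
    add_comm] at h
  exact (add_right_cancel h).symm

theorem exists_affineEquiv_eq_act (x : S2S3S3) :
    ∃ σ : (Fin 5 → ℂ) ≃ᵃ[ℂ] (Fin 5 → ℂ), ∀ a, σ a = act 1 x a :=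
  ⟨(symEquiv.symm x).1, fun a => by rw [symGroup_apply, MulEquiv.apply_symm_apply]⟩

theorem tendsto_act (x : S2S3S3) : Tendsto (act (1 : ℂ) x) far far := by
  obtain ⟨σ, hσ⟩ := exists_affineEquiv_eq_act x
  rw [← funext hσ]
  exact tendsto_far σ (c := 0) fun a => by rw [hσ, saal_act, add_zero]

theorem card_symGroup : Nat.card symGroup = 72 := by
  rw [Nat.card_congr symEquiv.toEquiv, Nat.card_congr SemidirectProduct.equivProd, Nat.card_prod,
    Nat.card_fun, Nat.card_perm, Nat.card_perm]
  simp [Nat.factorial]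

/-! ### Contiguity relations -/

/-- The shift to the neighbour at a place: `eᵢ` for the upper parameters, `-eᵢ` for the lower ones,
and `(1, …, 1)` at the place `(1, 0)`. -/
def nbr (y : Fin 2 × Fin 3) : Fin 5 → ℤ := ofTriples 0 (Pi.single y (placeSign y : ℤ))

/-- The weights `a₀, a₁, a₂; 0, a₃ - 1, a₄ - 1`: the summand of `f(a + nbr y)` is the summand of
`f(a)` times `weight a y + k`. -/
def weight {R : Type*} [CommRing R] (a : Fin 5 → R) (y : Fin 2 × Fin 3) : R :=
  triples 1 a y - if y.1 = 0 then 0 else 1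

theorem nbr_one_zero : nbr (1, 0) = 1 := by decide

theorem saal_nbr (y : Fin 2 × Fin 3) : saal (nbr y) = -1 := by revert y; decide

theorem weight_one_zero {R : Type*} [CommRing R] (a : Fin 5 → R) : weight a (1, 0) = 0 := by
  simp [weight, triples_one_zero]

theorem add_intVec_zero (a : Fin 5 → ℂ) : a + intVec ℂ 0 = a := by
  ext j
  simp [intVec]

/-- The contiguity relations: `h(a + nbr y) - weight a y * h(a)` is the same for all `y`. This form
of the relations is symmetric under `S₂ ⋉ (S₃ × S₃)`. -/
def Contig (h : (Fin 5 → ℂ) → ℂ) : Prop :=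
  ∀ᶠ a in far, ∀ y z, h (a + intVec ℂ (nbr y)) - h (a + intVec ℂ (nbr z)) =
    (weight a y - weight a z) * h a

/-- The summand of `f(a)`. -/
def hgfTerm (a : Fin 5 → ℂ) (k : ℕ) : ℂ :=
  Complex.Gamma (a 0 + k) * Complex.Gamma (a 1 + k) * Complex.Gamma (a 2 + k) /
    (Complex.Gamma (1 + k) * Complex.Gamma (a 3 + k) * Complex.Gamma (a 4 + k))

theorem hasSum_hgfTerm {a : Fin 5 → ℂ} (ha : Generic a) (hs : 0 < (saal a).re) :
    HasSum (hgfTerm a) (hgf a 1) := by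
  have hterm : hgfTerm a = fun k => Complex.Gamma (a 0) * Complex.Gamma (a 1) *
      Complex.Gamma (a 2) * regTerm a k := by
    funext k
    rw [← hgf_term_eq (ha.1 0) (ha.1 1) (ha.1 2), one_pow, mul_one, hgfTerm]
  rw [hgf_one_eq (ha.1 0) (ha.1 1) (ha.1 2), hterm]
  exact (summable_regTerm hs).hasSum.mul_left _

theorem hgfTerm_add_one (a : Fin 5 → ℂ) (k : ℕ) :
    hgfTerm (a + 1) k = ((k + 1 : ℕ) : ℂ) * hgfTerm a (k + 1) := by
  have hGamma : Complex.Gamma (1 + (k + 1 : ℕ)) = (k + 1 : ℕ) * Complex.Gamma (1 + k) := by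
    have h0 : (1 : ℂ) + k ≠ 0 := by exact_mod_cast (by omega : 1 + k ≠ 0)
    push_cast
    rw [add_comm (k : ℂ) 1, add_comm (1 : ℂ), Complex.Gamma_add_one _ h0]
  have hk : ((k + 1 : ℕ) : ℂ) ≠ 0 := Nat.cast_ne_zero.2 (by omega)
  simp only [hgfTerm, hGamma, Pi.add_apply, Pi.one_apply]
  rw [mul_assoc ((k + 1 : ℕ) : ℂ), mul_assoc ((k + 1 : ℕ) : ℂ), ← mul_div_assoc,
    mul_div_mul_left _ _ hk]
  push_cast
  simp only [add_assoc, add_comm (1 : ℂ)]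

theorem saal_re_add_nbr (a : Fin 5 → ℂ) (y : Fin 2 × Fin 3) :
    (saal (a + intVec ℂ (nbr y))).re = (saal a).re - 1 := by
  rw [saal_add, saal_intVec, saal_nbr]
  simp [sub_eq_add_neg]

theorem hasSum_natCast_mul_hgfTerm {a : Fin 5 → ℂ} (ha : Generic a) (hs : 1 < (saal a).re) :
    HasSum (fun k : ℕ => (k : ℂ) * hgfTerm a k) (hgf (a + 1) 1) := by
  have h := hasSum_hgfTerm (ha.add_intVec (nbr (1, 0))) (by rw [saal_re_add_nbr]; linarith)
  rw [nbr_one_zero, intVec_one, funext (hgfTerm_add_one a)] at h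
  simpa using (hasSum_nat_add_iff (f := fun k : ℕ => (k : ℂ) * hgfTerm a k) 1).1 h

theorem hgfTerm_add_nbr_place {a : Fin 5 → ℂ} (ha : Generic a) (i : Fin 5) (k : ℕ) :
    hgfTerm (a + intVec ℂ (nbr (place i))) k = (weight a (place i) + k) * hgfTerm a k := by
  have hup : ∀ i, Complex.Gamma (a i + 1 + k) = (a i + k) * Complex.Gamma (a i + k) := fun i => by
    have h : a i + k ≠ 0 := fun h => ha.1 i (-k) (by push_cast; linear_combination h)
    rw [add_right_comm, Complex.Gamma_add_one _ h]
  have hdn : ∀ i, (Complex.Gamma (a i + -1 + k))⁻¹ =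
      (a i - 1 + k) * (Complex.Gamma (a i + k))⁻¹ := fun i => by
    rw [Complex.one_div_Gamma_eq_self_mul_one_div_Gamma_add_one]
    ring_nf
  fin_cases i <;>
    simp [hgfTerm, nbr, ofTriples, placeSign, weight, triples, place, intVec,
      div_eq_mul_inv, hup, hdn] <;>
    ring

theorem contig_hgf : Contig fun a => hgf a 1 := by
  filter_upwards [eventually_far_nonInt, eventually_lt_saal 1] with a ha hs
  have key : ∀ y, hgf (a + intVec ℂ (nbr y)) 1 = weight a y * hgf a 1 + hgf (a + 1) 1 := by
    intro y
    obtain rfl | ⟨i, rfl⟩ := eq_or_exists_eq_place y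
    · rw [nbr_one_zero, intVec_one, weight_one_zero, zero_mul, zero_add]
    · have hsum := ((hasSum_hgfTerm ha.generic (by linarith)).mul_left (weight a (place i))).add
        (hasSum_natCast_mul_hgfTerm ha.generic hs)
      simp only [← add_mul, ← hgfTerm_add_nbr_place ha.generic] at hsum
      exact (hasSum_hgfTerm (ha.generic.add_intVec _)
        (by rw [saal_re_add_nbr]; linarith)).unique hsum
  intro y z
  rw [key, key]
  ring

namespace Contig

variable {h : (Fin 5 → ℂ) → ℂ}

theorem add_nbr (hh : Contig h) : ∀ᶠ a in far, ∀ y,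
    h (a + intVec ℂ (nbr y)) = weight a y * h a + h (a + 1) := by
  filter_upwards [hh] with a ha y
  have := ha y (1, 0)
  rw [nbr_one_zero, intVec_one, weight_one_zero] at this
  linear_combination this

theorem shift (hh : Contig h) (p : Fin 5 → ℤ) (i : Fin 5) {q r : Fin 5 → ℤ} {c : ℤ}
    (hq : p + nbr (place i) = q) (hr : p + 1 = r)
    (hc : weight p (place i) = c) :
    ∀ᶠ a in far, h (a + intVec ℂ q) =
      (a i + c) * h (a + intVec ℂ p) + h (a + intVec ℂ r) := by
  filter_upwards [(tendsto_translation p).eventually hh.add_nbr] with a ha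
  have hw : weight (a + intVec ℂ p) (place i) = a i + c := by
    rw [← hc]
    simp only [weight, triples_place, Pi.add_apply, intVec]
    split_ifs <;> push_cast <;> ring
  rw [← hq, ← hr, intVec_add, intVec_add, ← add_assoc, ← add_assoc, ha, hw, intVec_one]

/-- The value at `a + e₀ + e₁ + e₂ = (a + 1) - e₃ - e₄` computed in two ways. -/
theorem second_order (hh : Contig h) :
    ∀ᶠ a in far, (saal a - 2) * h (a + 1 + 1) = phi3 a * h a +
      (phi2 a - (a 3 - 1) * (a 4 - 1) - (saal a - 2)) * h (a + 1) := by
  filter_upwards [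
    hh.shift 0 0 (q := ![1, 0, 0, 0, 0]) (r := 1) (c := 0) (by decide) (by decide) (by decide),
    hh.shift 1 0 (q := ![2, 1, 1, 1, 1]) (r := 2) (c := 1) (by decide) (by decide) (by decide),
    hh.shift 2 0 (q := ![3, 2, 2, 2, 2]) (r := 3) (c := 2) (by decide) (by decide) (by decide),
    hh.shift ![1, 0, 0, 0, 0] 1 (q := ![1, 1, 0, 0, 0]) (r := ![2, 1, 1, 1, 1]) (c := 0)
      (by decide) (by decide) (by decide),
    hh.shift ![2, 1, 1, 1, 1] 1 (q := ![2, 2, 1, 1, 1]) (r := ![3, 2, 2, 2, 2]) (c := 1)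
      (by decide) (by decide) (by decide),
    hh.shift ![1, 1, 0, 0, 0] 2 (q := ![1, 1, 1, 0, 0]) (r := ![2, 2, 1, 1, 1]) (c := 0)
      (by decide) (by decide) (by decide),
    hh.shift 1 3 (q := ![1, 1, 1, 0, 1]) (r := 2) (c := 0) (by decide) (by decide) (by decide),
    hh.shift 2 3 (q := ![2, 2, 2, 1, 2]) (r := 3) (c := 1) (by decide) (by decide) (by decide),
    hh.shift ![1, 1, 1, 0, 1] 4 (q := ![1, 1, 1, 0, 0]) (r := ![2, 2, 2, 1, 2]) (c := 0)
      (by decide) (by decide) (by decide)] with a e1 e2 e3 e4 e5 e6 e7 e8 e9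
  have htwo : intVec ℂ 2 = 1 + 1 := by
    ext j
    simp [intVec]
    norm_num
  rw [add_intVec_zero, intVec_one] at e1
  rw [htwo, intVec_one, ← add_assoc] at e2 e7
  rw [htwo, ← add_assoc] at e3 e8
  push_cast at e1 e2 e3 e4 e5 e6 e7 e8 e9
  rw [saal, phi2, phi3]
  linear_combination (e6 + a 2 * e4 + a 2 * a 1 * e1 + a 2 * e2 + e5 + (a 1 + 1) * e2 + e3) -
    (e9 + a 4 * e7 + e8)

theorem relations (hh : Contig h) (y : Fin 2 × Fin 3) : ∀ᶠ a in far,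
    h (a + intVec ℂ (nbr y)) = weight a y * h a + h (a + 1) ∧
    h (a + intVec ℂ (nbr y) + 1) = weight (a + 1) y * h (a + 1) + h (a + 1 + 1) ∧
    (saal a - 2) * h (a + 1 + 1) = phi3 a * h a +
      (phi2 a - (a 3 - 1) * (a 4 - 1) - (saal a - 2)) * h (a + 1) := by
  filter_upwards [hh.add_nbr, (tendsto_translation 1).eventually hh.add_nbr, hh.second_order]
    with a h1 h2 h3
  rw [intVec_one] at h2
  exact ⟨h1 y, by rw [add_right_comm, h2], h3⟩

end Contig

theorem step_eq_nbr (i : Fin 5) : step (i, decide (i < 3)) = nbr (place i) := by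
  revert i; decide

theorem step_add_nbr (i : Fin 5) : step (i, !decide (i < 3)) + nbr (place i) = 0 := by
  revert i; decide

namespace Contig

variable {h : (Fin 5 → ℂ) → ℂ}

theorem step_nbr (hh : Contig h) (i : Fin 5) : ∀ᶠ a in far,
    ![h (a + intVec ℂ (nbr (place i))), h (a + intVec ℂ (nbr (place i)) + 1)] =
      (contigMatrix a i (decide (i < 3))).mulVec ![h a, h (a + 1)] := by
  filter_upwards [hh.relations (place i), eventually_far_nonInt] with a ⟨e1, e2, e3⟩ ha
  have hs : saal a - 2 ≠ 0 := by simpa using ha.saal_sub_ne_zero 2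
  rw [e1, e2, eq_div_of_mul_eq hs ((mul_comm _ _).trans e3)]
  ext j
  fin_cases i <;> fin_cases j <;>
    simp [contigMatrix, upperPlus, lowerMinus, weight, triples, place, Matrix.mulVec, dotProduct,
      Fin.sum_univ_two] <;>
    field_simp <;>
    simp only [saal, phi1, phi2] <;>
    ring

/-- Here the relations at `b = a - nbr (place i)` are solved for `h(b)` and `h(b + 1)`. -/
theorem step_neg_nbr (hh : Contig h) (i : Fin 5) {p : Fin 5 → ℤ} (hp : p + nbr (place i) = 0) :
    ∀ᶠ a in far, ![h (a + intVec ℂ p), h (a + intVec ℂ p + 1)] =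
      (contigMatrix a i (!decide (i < 3))).mulVec ![h a, h (a + 1)] := by
  filter_upwards [(tendsto_translation p).eventually (hh.relations (place i)),
    eventually_far_nonInt] with a ⟨e1, e2, e3⟩ ha
  have hab : a + intVec ℂ p + intVec ℂ (nbr (place i)) = a := by
    rw [add_assoc, ← intVec_add, hp, add_intVec_zero]
  rw [hab] at e1 e2
  obtain rfl := eq_neg_of_add_eq_zero_left hp
  rw [e1, e2]
  generalize h (a + intVec ℂ (-nbr (place i))) = y₀ at e3 ⊢
  generalize h (a + intVec ℂ (-nbr (place i)) + 1) = y₁ at e3 ⊢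
  generalize h (a + intVec ℂ (-nbr (place i)) + 1 + 1) = y₂ at e3 ⊢
  ext j
  fin_cases i <;> fin_cases j <;>
    simp [contigMatrix, upperMinus, lowerPlus, weight, triples, place, nbr, ofTriples, placeSign,
      intVec, phi1, phi2, phi3, saal, Matrix.mulVec, dotProduct, Fin.sum_univ_two] at e3 ⊢ <;>
    field_simp (disch := first
      | exact ha.sub_one_ne_zero _
      | exact ha.sub_ne_zero (by decide))
  · linear_combination -e3
  · linear_combination e3
  · linear_combination -e3
  · linear_combination e3
  · linear_combination -e3
  · linear_combination e3
  · linear_combination e3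
  · linear_combination -a 3 * e3
  · linear_combination e3
  · linear_combination -a 4 * e3

theorem step (hh : Contig h) (d : Fin 5 × Bool) : ∀ᶠ a in far,
    ![h (a + intVec ℂ (step d)), h (a + intVec ℂ (step d) + 1)] =
      (contigMatrix a d.1 d.2).mulVec ![h a, h (a + 1)] := by
  obtain ⟨i, b⟩ := d
  obtain rfl | rfl : b = decide (i < 3) ∨ b = !decide (i < 3) := Bool.eq_or_eq_not _ _
  · rw [step_eq_nbr]
    exact hh.step_nbr i
  · exact hh.step_neg_nbr i (step_add_nbr i)

theorem path (hh : Contig h) (l : List (Fin 5 × Bool)) : ∀ᶠ a in far,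
    ![h (a + intVec ℂ (endpoint l)), h (a + intVec ℂ (endpoint l) + 1)] =
      (pathMatrix a l).mulVec ![h a, h (a + 1)] := by
  induction l with
  | nil => simp [endpoint, add_intVec_zero, pathMatrix]
  | cons d l ih =>
    filter_upwards [hh.step d, (tendsto_translation (ThreeTerm.step d)).eventually ih] with a h1 h2
    rw [← add_intVec_step, h2, h1, Matrix.mulVec_mulVec, pathMatrix]

theorem path_top (hh : Contig h) (l : List (Fin 5 × Bool)) : ∀ᶠ a in far,
    h (a + intVec ℂ (endpoint l)) =
      pathMatrix a l 0 0 * h a + pathMatrix a l 0 1 * h (a + 1) := by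
  filter_upwards [hh.path l] with a ha
  simpa [Matrix.mulVec, dotProduct, Fin.sum_univ_two] using congrFun ha 0

end Contig

/-! ### Symmetries of the contiguity relations -/

/-- The factor `1` or `e^{iπ s(a)}`, according to the sign. -/
def twist (χ : ℤˣ) (a : Fin 5 → ℂ) : ℂ :=
  if χ = 1 then 1 else Complex.exp (Complex.I * Real.pi * saal a)

theorem twist_one (a : Fin 5 → ℂ) : twist 1 a = 1 := if_pos rfl

theorem twist_neg_one (a : Fin 5 → ℂ) :
    twist (-1) a = Complex.exp (Complex.I * Real.pi * saal a) := if_neg (by decide)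

theorem twist_ne_zero (χ : ℤˣ) (a : Fin 5 → ℂ) : twist χ a ≠ 0 := by
  unfold twist
  split_ifs
  · exact one_ne_zero
  · exact Complex.exp_ne_zero _

theorem twist_add_intVec (χ : ℤˣ) (a : Fin 5 → ℂ) (p : Fin 5 → ℤ) :
    twist χ (a + intVec ℂ p) = (((χ ^ saal p : ℤˣ) : ℤ) : ℂ) * twist χ a := by
  rcases Int.units_eq_one_or χ with rfl | rfl
  · simp [twist_one]
  · rw [twist_neg_one, twist_neg_one, saal_add, saal_intVec, mul_add, add_comm, Complex.exp_add,
      show Complex.I * Real.pi * (saal p : ℤ) = (saal p : ℤ) * (Real.pi * Complex.I) by ring,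
      Complex.exp_int_mul, Complex.exp_pi_mul_I]
    rcases Int.even_or_odd (saal p) with hp | hp <;> simp [hp.neg_one_zpow]

theorem act_nbr (x : S2S3S3) (y : Fin 2 × Fin 3) : act 0 x (nbr y) = nbr (placePerm x y) := by
  refine (eq_act 0 x fun z z' => ?_).symm
  have hsingle : ∀ z, (Pi.single (placePerm x y) (placeSign (placePerm x y) : ℤ) :
      Fin 2 × Fin 3 → ℤ) (placePerm x z) =
        (sgn x : ℤ) * (Pi.single y (placeSign y : ℤ) : Fin 2 × Fin 3 → ℤ) z := fun z => by
    simp [Pi.single_apply, placeSign_placePerm]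
  simp only [nbr, triples_ofTriples, hsingle, Int.cast_id]
  ring

theorem weight_act_sub (x : S2S3S3) (a : Fin 5 → ℂ) (y z : Fin 2 × Fin 3) :
    weight (act 1 x a) (placePerm x y) - weight (act 1 x a) (placePerm x z) =
      (sgn x : ℤ) * (weight a y - weight a z) := by
  have hlower : ∀ y : Fin 2 × Fin 3,
      (if y.1 = 0 then 0 else 1 : ℂ) = (1 - (placeSign y : ℤ)) / 2 := fun y => by
    unfold placeSign
    split_ifs <;> norm_num
  have h := triples_act_sub 1 x a y z
  simp only [weight, hlower, placeSign_placePerm]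
  push_cast
  linear_combination h

/-- The action preserves the contiguity relations up to the sign `χ`, which the twist absorbs. -/
theorem Contig.comp_act {h : (Fin 5 → ℂ) → ℂ} (hh : Contig h) (x : S2S3S3) :
    Contig fun a => twist (sgn x) a * h (act 1 x a) := by
  filter_upwards [(tendsto_act x).eventually hh] with a ha y z
  have hsgn : ∀ y, sgn x ^ saal (nbr y) = sgn x := fun y => by
    rw [saal_nbr, zpow_neg_one, Int.units_inv_eq_self]
  simp only [twist_add_intVec, hsgn, act_add_intVec, act_nbr]
  linear_combination (sgn x : ℤ) * twist (sgn x) a * (ha (placePerm x y) (placePerm x z) +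
    h (act 1 x a) * weight_act_sub x a y z) +
    twist (sgn x) a * h (act 1 x a) * (weight a y - weight a z) * sgn_mul_self (R := ℂ) x

theorem companion_eq (ν : SingPt) (i : Fin 3) :
    companion ν i = fun a => twist (sgn (genElt ν i)) a * hgf (act 1 (genElt ν i) a) 1 := by
  funext a
  rw [act_genElt]
  cases ν
  · simp [companion, solution, genElt, sgn, twist_one]
  · have : sgn (genElt .infty i) = -1 := by simp [genElt, sgn]
    simp [companion, solution, this, twist_neg_one]

/-! ### Linear independence -/

section Divisibility

variable {K σ : Type*} [Field K]

theorem X_dvd_of_eval_eq_zero [Finite σ] {i : σ} {P : MvPolynomial σ K}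
    (h : ∀ N : ℕ, ∃ S : σ → Finset K, (∀ j, N < (S j).card) ∧
      ∀ a : σ → K, a i = 0 → (∀ j ≠ i, a j ∈ S j) → MvPolynomial.eval a P = 0) :
    MvPolynomial.X i ∣ P := by
  classical
  let Q : σ → MvPolynomial σ K := Function.update MvPolynomial.X i 0
  obtain ⟨S, hS, hP⟩ := h (MvPolynomial.bind₁ Q P).totalDegree
  have hzero : MvPolynomial.bind₁ Q P = 0 := by
    refine MvPolynomial.eq_zero_of_eval_zero_at_prod_finset _ S
      (fun j => (MvPolynomial.degreeOf_le_totalDegree _ j).trans_lt (hS j)) fun a ha => ?_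
    rw [MvPolynomial.eval, MvPolynomial.eval₂Hom_bind₁]
    exact hP _ (by simp [Q]) fun j hj => by simpa [Q, hj] using ha j
  have hquot : (Ideal.Quotient.mkₐ K (Ideal.span {MvPolynomial.X i})).comp (MvPolynomial.bind₁ Q) =
      Ideal.Quotient.mkₐ K (Ideal.span {MvPolynomial.X i}) := by
    refine MvPolynomial.algHom_ext fun j => ?_
    obtain rfl | hj := eq_or_ne j i
    · simp [Q]
    · simp [Q, hj]
  have hPquot := DFunLike.congr_fun hquot P
  rw [AlgHom.comp_apply, hzero, map_zero] at hPquot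
  exact Ideal.mem_span_singleton.1 (Ideal.Quotient.eq_zero_iff_mem.1 hPquot.symm)

theorem eq_zero_of_X_pow_dvd {i : σ} {P : MvPolynomial σ K}
    (h : ∀ n : ℕ, MvPolynomial.X i ^ n ∣ P) : P = 0 := by
  by_contra hP
  obtain ⟨n, hn⟩ :=
    FiniteMultiplicity.of_not_isUnit (MvPolynomial.X_prime (i := i)).not_isUnit hP
  exact hn (h _)

theorem X_dvd_of_eval_intVec_eq_zero {P : MvPolynomial (Fin 5) ℂ} {i : Fin 5}
    (h : ∀ N : ℕ, ∃ l : Fin 5 → ℤ, ∀ m : Fin 5 → ℤ, m i = 0 →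
      (∀ j ≠ i, l j ≤ m j ∧ m j ≤ l j + N) → MvPolynomial.eval (intVec ℂ m) P = 0) :
    MvPolynomial.X i ∣ P := by
  refine X_dvd_of_eval_eq_zero fun N => ?_
  obtain ⟨l, hl⟩ := h N
  refine ⟨fun j => (Finset.Icc (l j) (l j + N)).map ⟨Int.cast, Int.cast_injective⟩, fun j => ?_,
    fun a hai ha => ?_⟩
  · rw [Finset.card_map, Int.card_Icc]
    omega
  · have hint : ∀ j, ∃ n : ℤ, (n : ℂ) = a j ∧ if j = i then n = 0 else l j ≤ n ∧ n ≤ l j + N := by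
      intro j
      split_ifs with hj
      · exact ⟨0, by rw [hj, hai, Int.cast_zero], rfl⟩
      · simpa [and_comm] using ha j hj
    choose m hma hm using hint
    rw [← show intVec ℂ m = a from funext hma]
    exact hl m (by simpa using hm i) fun j hj => by simpa [hj] using hm j

end Divisibility

section Positivity

open scoped ComplexOrder

theorem inv_Gamma_intCast_pos {n : ℤ} (hn : 0 < n) : 0 < (Complex.Gamma n)⁻¹ := by
  have h := Real.Gamma_pos_of_pos (Int.cast_pos.2 hn)
  rw [← Complex.ofReal_intCast, Complex.Gamma_ofReal]
  exact inv_pos.2 (Complex.zero_lt_real.2 h)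

theorem inv_Gamma_intCast_nonneg (n : ℤ) : 0 ≤ (Complex.Gamma n)⁻¹ := by
  obtain hn | hn := lt_or_ge 0 n
  · exact (inv_Gamma_intCast_pos hn).le
  · obtain ⟨m, rfl⟩ := Int.exists_eq_neg_ofNat hn
    simp [Complex.Gamma_neg_nat_eq_zero]

theorem prod_intCast_add_pos {n : ℤ} (hn : 0 < n) (k : ℕ) :
    0 < ∏ j ∈ Finset.range k, ((n : ℂ) + j) :=
  Finset.prod_pos fun j _ => by
    exact_mod_cast (by positivity : 0 < n + j)

theorem regSum_intVec_ne_zero {m : Fin 5 → ℤ} (h0 : 0 < m 0) (h1 : 0 < m 1) (h2 : 0 < m 2)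
    (h4 : 0 < m 4) (hs : 0 < saal m) : regSum (intVec ℂ m) ≠ 0 := by
  have hsum : Summable (regTerm (intVec ℂ m)) :=
    summable_regTerm (by rw [saal_intVec]; exact_mod_cast hs)
  have hcast : ∀ j (k : ℕ), intVec ℂ m j + k = ((m j + k : ℤ) : ℂ) := fun j k => by
    simp [intVec]
  have hΓ : ∀ j, 0 < m j → ∀ k : ℕ, 0 < (Complex.Gamma (intVec ℂ m j + k))⁻¹ := fun j hj k =>
    hcast j k ▸ inv_Gamma_intCast_pos (by positivity)
  have hΓ1 : ∀ k : ℕ, 0 < (Complex.Gamma (1 + k))⁻¹ := fun k => by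
    exact_mod_cast inv_Gamma_intCast_pos (n := 1 + k) (by positivity)
  have hprod : ∀ k : ℕ, 0 < (∏ j ∈ Finset.range k, (intVec ℂ m 0 + j)) *
      (∏ j ∈ Finset.range k, (intVec ℂ m 1 + j)) *
      (∏ j ∈ Finset.range k, (intVec ℂ m 2 + j)) := fun k =>
    mul_pos (mul_pos (prod_intCast_add_pos h0 k) (prod_intCast_add_pos h1 k))
      (prod_intCast_add_pos h2 k)
  have hnonneg : ∀ k, 0 ≤ regTerm (intVec ℂ m) k := fun k =>
    mul_nonneg (hprod k).le (mul_nonneg (mul_nonneg (hΓ1 k).le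
      (hcast 3 k ▸ inv_Gamma_intCast_nonneg _)) (hΓ 4 h4 k).le)
  have hpos : 0 < regTerm (intVec ℂ m) ((m 3).natAbs + 1) :=
    mul_pos (hprod _) (mul_pos (mul_pos (hΓ1 _)
      (hcast 3 _ ▸ inv_Gamma_intCast_pos (by omega))) (hΓ 4 h4 _))
  exact (hsum.tsum_pos hnonneg _ hpos).ne'

end Positivity

theorem regSum_of_zero {a : Fin 5 → ℂ} (h : a 0 = 0) :
    regSum a = (Complex.Gamma (a 3))⁻¹ * (Complex.Gamma (a 4))⁻¹ := by
  rw [regSum, tsum_eq_single 0]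
  · simp [regTerm]
  · intro k hk
    have : ∏ j ∈ Finset.range k, (a 0 + j) = 0 :=
      Finset.prod_eq_zero (Finset.mem_range.2 (Nat.pos_of_ne_zero hk)) (by simp [h])
    simp [regTerm, this]

theorem continuousAt_regSum_add {a : Fin 5 → ℂ} {p : Fin 5 → ℤ}
    (h : 0 < (saal (a + intVec ℂ p)).re) : ContinuousAt (fun x => regSum (x + intVec ℂ p)) a :=
  ContinuousAt.comp (g := regSum) (f := fun x => x + intVec ℂ p) (continuousAt_regSum h)
    (by fun_prop)

/-- The relation `A(a) F(a) + B(a) F(a + p) = 0` for the regularized series `F`, whenever `Re s(a)`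
is large. -/
def RegRel (p : Fin 5 → ℤ) (A B : MvPolynomial (Fin 5) ℂ) : Prop :=
  ∀ᶠ a in far, MvPolynomial.eval a A * regSum a +
    MvPolynomial.eval a B * regSum (a + intVec ℂ p) = 0

namespace RegRel

variable {p : Fin 5 → ℤ} {A B : MvPolynomial (Fin 5) ℂ}

theorem exists_intVec (h : RegRel p A B) : ∃ M : ℕ, ∀ m : Fin 5 → ℤ, M < saal m →
    0 < saal (m + p) ∧ MvPolynomial.eval (intVec ℂ m) A * regSum (intVec ℂ m) +
      MvPolynomial.eval (intVec ℂ m) B * regSum (intVec ℂ (m + p)) = 0 := by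
  obtain ⟨M, hM⟩ := eventually_far.1 h
  refine ⟨⌈M⌉₊ + (saal p).natAbs, fun m hm => ?_⟩
  rw [Nat.cast_add] at hm
  have hMm : (⌈M⌉₊ : ℤ) < saal m := by omega
  have hp : 0 < saal (m + p) := by
    rw [show saal (m + p) = saal m + saal p by simp only [saal, Pi.add_apply]; ring]
    omega
  have hs : ∀ m : Fin 5 → ℤ, 0 < saal m → 0 < (saal (intVec ℂ m)).re := fun m hm => by
    rw [saal_intVec]
    exact_mod_cast hm
  refine ⟨hp, ?_⟩
  rw [intVec_add]
  refine eq_zero_of_continuousAt (M := M) (g := fun a => MvPolynomial.eval a A * regSum a +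
    MvPolynomial.eval a B * regSum (a + intVec ℂ p)) ?_ ?_ hM
  · exact ((MvPolynomial.continuous_eval A).continuousAt.mul
      (continuousAt_regSum (hs m (by omega)))).add
      ((MvPolynomial.continuous_eval B).continuousAt.mul
        (continuousAt_regSum_add (intVec_add (K := ℂ) m p ▸ hs _ hp)))
  · rw [saal_intVec]
    exact (Nat.le_ceil M).trans_lt (by exact_mod_cast hMm)

/-- On `a₀ = 0`, `a₃ = -n` the series `F(a)` vanishes and `F(a + p)` does not. -/
theorem X_dvd_right (h : RegRel p A B) (hp : 1 ≤ p 0) : MvPolynomial.X 0 ∣ B := by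
  obtain ⟨M, hM⟩ := h.exists_intVec
  refine X_dvd_of_eval_intVec_eq_zero fun N =>
    ⟨![0, 1 - p 1, 1 - p 2, -N, M + 3 * N + 3 + (p 1).natAbs + (p 2).natAbs + (p 4).natAbs],
      fun m hm0 hm => ?_⟩
  have hm1 := hm 1 (by decide)
  have hm2 := hm 2 (by decide)
  have hm3 := hm 3 (by decide)
  have hm4 := hm 4 (by decide)
  simp only [Matrix.cons_val] at hm1 hm2 hm3 hm4
  obtain ⟨hs, hrel⟩ := hM m (by simp only [saal]; omega)
  have hzero : regSum (intVec ℂ m) = 0 := by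
    obtain ⟨n, hn⟩ := Int.exists_eq_neg_ofNat (show m 3 ≤ 0 by omega)
    rw [regSum_of_zero (by simp [intVec, hm0])]
    simp [intVec, hn, Complex.Gamma_neg_nat_eq_zero]
  rw [hzero, mul_zero, zero_add] at hrel
  refine (mul_eq_zero.1 hrel).resolve_right (regSum_intVec_ne_zero ?_ ?_ ?_ ?_ hs) <;>
    simp only [Pi.add_apply] <;> omega

open scoped ComplexOrder in
theorem X_dvd_left (h : RegRel p A (MvPolynomial.X 0 * B)) : MvPolynomial.X 0 ∣ A := by
  obtain ⟨M, hM⟩ := h.exists_intVec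
  refine X_dvd_of_eval_intVec_eq_zero fun N => ⟨![0, -N, -N, 1, M + 1], fun m hm0 hm => ?_⟩
  have hm1 := hm 1 (by decide)
  have hm2 := hm 2 (by decide)
  have hm3 := hm 3 (by decide)
  have hm4 := hm 4 (by decide)
  simp only [Matrix.cons_val] at hm1 hm2 hm3 hm4
  obtain ⟨-, hrel⟩ := hM m (by simp only [saal]; omega)
  have hX : intVec ℂ m 0 = 0 := by simp [intVec, hm0]
  rw [map_mul, MvPolynomial.eval_X, hX, zero_mul, zero_mul, add_zero, regSum_of_zero hX] at hrel
  exact (mul_eq_zero.1 hrel).resolve_right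
    (mul_pos (inv_Gamma_intCast_pos (n := m 3) (by omega))
      (inv_Gamma_intCast_pos (n := m 4) (by omega))).ne'

theorem X_pow_dvd (hp : 1 ≤ p 0) (n : ℕ) : ∀ {A B}, RegRel p A B →
    MvPolynomial.X 0 ^ n ∣ A ∧ MvPolynomial.X 0 ^ n ∣ B := by
  induction n with
  | zero => simp
  | succ n ih =>
    intro A B h
    obtain ⟨B, rfl⟩ := h.X_dvd_right hp
    obtain ⟨A, rfl⟩ := h.X_dvd_left
    obtain ⟨hA, hB⟩ := ih (A := A) (B := B) (by
      filter_upwards [h, eventually_far_nonInt] with a ha hint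
      have hX : a 0 ≠ 0 := by simpa using hint.entry 0 0
      simp only [map_mul, MvPolynomial.eval_X] at ha
      exact (mul_eq_zero.1 (by linear_combination ha)).resolve_left hX)
    rw [pow_succ']
    exact ⟨mul_dvd_mul_left _ hA, mul_dvd_mul_left _ hB⟩

theorem eq_zero (h : RegRel p A B) (hp : 1 ≤ p 0) : A = 0 ∧ B = 0 :=
  ⟨eq_zero_of_X_pow_dvd fun n => (X_pow_dvd hp n h).1,
    eq_zero_of_X_pow_dvd fun n => (X_pow_dvd hp n h).2⟩

end RegRel

/-- Linear independence of two functions over `ℂ(a)`, for relations which hold sufficiently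
generically on a half space. -/
def Indep (F G : (Fin 5 → ℂ) → ℂ) : Prop :=
  ∀ φ ψ : (Fin 5 → ℂ) → ℂ, IsRat φ → IsRat ψ → (∀ᶠ a in far, φ a * F a + ψ a * G a = 0) →
    (∀ᶠ a in far, φ a = 0) ∧ ∀ᶠ a in far, ψ a = 0

namespace Indep

variable {F G : (Fin 5 → ℂ) → ℂ}

theorem of_eval (h : ∀ A B : MvPolynomial (Fin 5) ℂ,
    (∀ᶠ a in far, MvPolynomial.eval a A * F a + MvPolynomial.eval a B * G a = 0) →
      A = 0 ∧ B = 0) : Indep F G := by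
  rintro φ ψ ⟨P, Q, hQ, hφ⟩ ⟨P', Q', hQ', hψ⟩ hrel
  obtain ⟨hP, hP'⟩ := h (P * Q') (P' * Q) (by
    filter_upwards [hφ, hψ, hrel] with a hφ hψ hrel
    rw [map_mul, map_mul, ← hφ, ← hψ]
    linear_combination MvPolynomial.eval a Q * MvPolynomial.eval a Q' * hrel)
  rw [(mul_eq_zero.1 hP).resolve_right hQ'] at hφ
  rw [(mul_eq_zero.1 hP').resolve_right hQ] at hψ
  simp only [map_zero] at hφ hψ
  exact ⟨eventually_eq_zero_of_mul_eval hQ hφ, eventually_eq_zero_of_mul_eval hQ' hψ⟩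

theorem swap (h : Indep F G) : Indep G F := fun φ ψ hφ hψ hrel =>
  (h ψ φ hψ hφ (hrel.mono fun _ ha => (add_comm _ _).trans ha)).symm

theorem of_eq_mul (h : Indep F G) {F' G' c ρ : (Fin 5 → ℂ) → ℂ} (hρ : IsRat ρ)
    (hc : ∀ᶠ a in far, c a ≠ 0) (hρ0 : ∀ᶠ a in far, ρ a ≠ 0)
    (hF : ∀ᶠ a in far, F' a = c a * F a) (hG : ∀ᶠ a in far, G' a = c a * (ρ a * G a)) :
    Indep F' G' := by
  intro φ ψ hφ hψ hrel
  obtain ⟨h1, h2⟩ := h φ (fun a => ψ a * ρ a) hφ (hψ.mul hρ) (by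
    filter_upwards [hc, hF, hG, hrel] with a hc hF hG hrel
    rw [hF, hG] at hrel
    exact (mul_eq_zero.1 (by linear_combination hrel)).resolve_left hc)
  exact ⟨h1, by
    filter_upwards [h2, hρ0] with a ha hρ0 using (mul_eq_zero.1 ha).resolve_right hρ0⟩

theorem comp_affineEquiv (h : Indep F G) (σ : (Fin 5 → ℂ) ≃ᵃ[ℂ] (Fin 5 → ℂ)) {c : ℂ}
    (hσ : ∀ a, saal (σ a) = saal a + c) : Indep (fun a => F (σ a)) fun a => G (σ a) := by
  have hσ' : ∀ a, saal (σ.symm a) = saal a + -c := fun a => by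
    rw [← σ.apply_symm_apply a, hσ, σ.symm_apply_apply, add_neg_cancel_right]
  intro φ ψ hφ hψ hrel
  obtain ⟨h1, h2⟩ := h _ _ (hφ.comp_affineEquiv σ.symm hσ') (hψ.comp_affineEquiv σ.symm hσ')
    (by simpa only [σ.apply_symm_apply] using (tendsto_far σ.symm hσ').eventually hrel)
  exact ⟨by simpa only [σ.symm_apply_apply] using (tendsto_far σ hσ).eventually h1,
    by simpa only [σ.symm_apply_apply] using (tendsto_far σ hσ).eventually h2⟩

theorem comp_translation (h : Indep F G) (p : Fin 5 → ℤ) :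
    Indep (fun a => F (a + intVec ℂ p)) fun a => G (a + intVec ℂ p) := by
  simpa only [← translation_apply] using
    h.comp_affineEquiv (translation p) fun a => by rw [translation_apply, saal_add]

theorem comp_act {F : (Fin 5 → ℂ) → ℂ} (x : S2S3S3) {p : Fin 5 → ℤ}
    (h : Indep F fun a => F (a + intVec ℂ (act 0 x p))) :
    Indep (fun a => twist (sgn x) a * F (act 1 x a))
      fun a => twist (sgn x) (a + intVec ℂ p) * F (act 1 x (a + intVec ℂ p)) := by
  obtain ⟨σ, hσ⟩ := exists_affineEquiv_eq_act x
  have hcomp := h.comp_affineEquiv σ (c := 0) fun a => by rw [hσ, saal_act, add_zero]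
  simp only [hσ] at hcomp
  refine hcomp.of_eq_mul (c := twist (sgn x)) (.const (((sgn x ^ saal p : ℤˣ) : ℤ) : ℂ))
    (.of_forall fun a => twist_ne_zero _ a) (.of_forall fun _ => by simp)
    (.of_forall fun _ => rfl) (.of_forall fun a => ?_)
  rw [twist_add_intVec, act_add_intVec]
  ring

end Indep

theorem Gamma_add_intCast {x : ℂ} (hx : ∀ n : ℤ, x ≠ n) (n : ℤ) :
    Complex.Gamma (x + n) = poch x n * Complex.Gamma x := by
  have hne : ∀ n : ℤ, x + n ≠ 0 := fun n h => hx (-n) (by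
    push_cast
    linear_combination h)
  induction n using Int.induction_on with
  | zero => simp [poch_zero]
  | succ n ih =>
    rw [poch_add_one hx, mul_right_comm, ← ih, mul_comm, ← Complex.Gamma_add_one _ (hne n)]
    push_cast
    rw [add_assoc]
  | pred n ih =>
    have hΓ := Complex.Gamma_add_one _ (hne (-n - 1))
    have hpoch := poch_add_one hx (-n - 1)
    rw [sub_add_cancel] at hpoch
    rw [show x + ((-n - 1 : ℤ) : ℂ) + 1 = x + (-n : ℤ) by push_cast; ring, ih, hpoch] at hΓ
    exact mul_left_cancel₀ (hne (-n - 1)) (by linear_combination -hΓ)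

theorem IsRat.poch {φ : (Fin 5 → ℂ) → ℂ} (hφ : IsRat φ) (n : ℤ) :
    IsRat fun a => ThreeTerm.poch (φ a) n := by
  have hprod : ∀ (n : ℕ) (c : ℕ → ℂ), IsRat fun a => ∏ k ∈ Finset.range n, (φ a + c k) := by
    intro n c
    induction n with
    | zero => simpa using IsRat.const 1
    | succ n ih => simpa only [Finset.prod_range_succ] using ih.mul (hφ.add (.const _))
  cases n with
  | ofNat n => exact hprod n fun k => k
  | negSucc n =>
    simpa only [ThreeTerm.poch, sub_eq_add_neg] using (hprod (n + 1) fun k => -(k + 1)).inv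

theorem poch_ne_zero {x : ℂ} (hx : ∀ n : ℤ, x ≠ n) (n : ℤ) : poch x n ≠ 0 := by
  have h := poch_add hx n (-n)
  rw [add_neg_cancel, poch_zero] at h
  exact left_ne_zero_of_mul (h ▸ one_ne_zero)

theorem indep_hgf_of_pos {p : Fin 5 → ℤ} (hp : 1 ≤ p 0) :
    Indep (fun a => hgf a 1) fun a => hgf (a + intVec ℂ p) 1 := by
  have hreg : Indep regSum fun a => regSum (a + intVec ℂ p) :=
    .of_eval fun A B h => RegRel.eq_zero h hp
  have hne : ∀ {a : Fin 5 → ℂ}, NonInt a → ∀ j, Complex.Gamma (a j) ≠ 0 := fun ha j =>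
    Complex.Gamma_ne_zero fun n => by exact_mod_cast ha.entry j (-n)
  refine hreg.of_eq_mul
    (c := fun a => Complex.Gamma (a 0) * Complex.Gamma (a 1) * Complex.Gamma (a 2))
    (ρ := fun a => poch (a 0) (p 0) * poch (a 1) (p 1) * poch (a 2) (p 2))
    ((((IsRat.coord 0).poch _).mul ((IsRat.coord 1).poch _)).mul ((IsRat.coord 2).poch _))
    ?_ ?_ ?_ ?_
  all_goals filter_upwards [eventually_far_nonInt] with a ha
  · exact mul_ne_zero (mul_ne_zero (hne ha 0) (hne ha 1)) (hne ha 2)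
  · exact mul_ne_zero (mul_ne_zero (poch_ne_zero (ha.entry 0) _) (poch_ne_zero (ha.entry 1) _))
      (poch_ne_zero (ha.entry 2) _)
  · exact hgf_one_eq (ha.entry 0) (ha.entry 1) (ha.entry 2)
  · have hap := ha.add_intVec p
    rw [hgf_one_eq (hap.entry 0) (hap.entry 1) (hap.entry 2)]
    simp only [Pi.add_apply, intVec, Gamma_add_intCast (ha.entry _)]
    ring

theorem indep_hgf_of_ne_zero {p : Fin 5 → ℤ} (hp : p 0 ≠ 0) :
    Indep (fun a => hgf a 1) fun a => hgf (a + intVec ℂ p) 1 := by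
  obtain hp | hp := hp.lt_or_gt
  · have h := (indep_hgf_of_pos (p := -p) (by rw [Pi.neg_apply]; omega)).comp_translation p
    simp only [add_assoc, ← intVec_add, add_neg_cancel, add_intVec_zero] at h
    exact h.swap
  · exact indep_hgf_of_pos hp

theorem exists_act_ne_zero {p : Fin 5 → ℤ} (hp : p ≠ 0) : ∃ x : S2S3S3, act 0 x p 0 ≠ 0 := by
  by_contra! h
  have h0 : p 0 = 0 := by simpa only [act_one] using h 1
  have h1 : -p 3 + p 1 = 0 := by
    rw [← h (genElt .infty 1)]
    simp [act, ofTriples, genElt, placePerm_symm_apply, place, triples, sgn]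
  have h2 : -p 4 + p 2 = 0 := by
    rw [← h (genElt .infty 2)]
    simp [act, ofTriples, genElt, placePerm_symm_apply, place, triples, sgn]
  have h3 : p 0 + -p 3 = 0 := by
    rw [← h (genElt .zero 1)]
    simp [act, ofTriples, genElt, placePerm_symm_apply, place, triples, sgn]
  have h4 : p 0 + -p 4 = 0 := by
    rw [← h (genElt .zero 2)]
    simp [act, ofTriples, genElt, placePerm_symm_apply, place, triples, sgn]
  have hzero : ∀ j, p j = 0
    | 0 => h0
    | 1 | 2 | 3 | 4 => by omega
  exact hp (funext hzero)

theorem Contig.eventually_top_right_ne_zero {h : (Fin 5 → ℂ) → ℂ} (hh : Contig h)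
    {l : List (Fin 5 × Bool)} (hind : Indep h fun a => h (a + intVec ℂ (endpoint l))) :
    ∀ᶠ a in far, pathMatrix a l 0 1 ≠ 0 := by
  refine (isRat_pathMatrix l 0 1).eventually_eq_zero_or.resolve_left fun h0 => ?_
  obtain ⟨-, h1⟩ := hind _ _ (isRat_pathMatrix l 0 0) (.const (-1)) (by
    filter_upwards [h0, hh.path_top l] with a h0 htop
    rw [htop, h0]
    ring)
  obtain ⟨_, h1⟩ := h1.exists
  exact neg_ne_zero.2 one_ne_zero h1

theorem eventually_top_right_ne_zero {l : List (Fin 5 × Bool)} (hl : endpoint l ≠ 0) :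
    ∀ᶠ a in far, pathMatrix a l 0 1 ≠ 0 := by
  obtain ⟨x, hx⟩ := exists_act_ne_zero hl
  exact (contig_hgf.comp_act x).eventually_top_right_ne_zero
    (Indep.comp_act (F := fun a => hgf a 1) x (indep_hgf_of_ne_zero hx))

/-! ### Relations among the companion functions -/

theorem endpoint_replicate (i : Fin 5) (n : ℤ) :
    endpoint (List.replicate n.natAbs (i, decide (0 ≤ n))) = Pi.single i n := by
  rw [endpoint, List.map_replicate, List.sum_replicate, step, ← Pi.single_smul]
  congr 1
  rcases le_or_gt 0 n with h | h
  · simp [h]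
  · simp [not_le.2 h, abs_of_neg h]

theorem exists_path (r : Fin 5 → ℤ) :
    ∃ l : List (Fin 5 × Bool), endpoint l = r ∧ l.length = ∑ j, (r j).natAbs := by
  refine ⟨(List.finRange 5).flatMap fun j => List.replicate (r j).natAbs (j, decide (0 ≤ r j)),
    ?_, ?_⟩
  · have hflat : ∀ L : List (Fin 5), endpoint (L.flatMap fun j =>
        List.replicate (r j).natAbs (j, decide (0 ≤ r j))) =
          (L.map fun j => Pi.single j (r j)).sum := by
      intro L
      induction L with
      | nil => rfl
      | cons j L ih =>
        rw [List.flatMap_cons, endpoint_append, endpoint_replicate, ih, List.map_cons,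
          List.sum_cons]
    rw [hflat, ← List.ofFn_eq_map, List.sum_ofFn, Finset.univ_sum_single]
  · simp only [List.length_flatMap, List.length_replicate, ← List.ofFn_eq_map, List.sum_ofFn]

theorem indep_hgf_add_intVec {p : Fin 5 → ℤ} (hp : p ≠ 0) :
    Indep (fun a => hgf a 1) fun a => hgf (a + intVec ℂ p) 1 := by
  obtain ⟨l, rfl, -⟩ := exists_path p
  intro φ ψ hφ hψ hrel
  obtain ⟨h0, h1⟩ := indep_hgf_of_pos (p := 1) le_rfl _ _
    (hφ.add (hψ.mul (isRat_pathMatrix l 0 0))) (hψ.mul (isRat_pathMatrix l 0 1)) (by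
      filter_upwards [hrel, contig_hgf.path_top l] with a hrel htop
      rw [intVec_one]
      linear_combination hrel - ψ a * htop)
  have hψ0 : ∀ᶠ a in far, ψ a = 0 := by
    filter_upwards [h1, eventually_top_right_ne_zero hp] with a h1 hne
      using (mul_eq_zero.1 h1).resolve_right hne
  refine ⟨?_, hψ0⟩
  filter_upwards [h0, hψ0] with a h0 hψ0
  simpa only [hψ0, zero_mul, add_zero] using h0

theorem indep_companion (ν : SingPt) (i : Fin 3) {p q : Fin 5 → ℤ} (hpq : p ≠ q) :
    Indep (fun a => companion ν i (a + intVec ℂ p)) fun a => companion ν i (a + intVec ℂ q) := by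
  have hact : act 0 (genElt ν i) (q - p) ≠ 0 := fun h => hpq (sub_eq_zero.1
    (by rw [← act_inv_act 0 (genElt ν i) (q - p), h, act_zero_zero])).symm
  have h := (Indep.comp_act (F := fun a => hgf a 1) _
    (indep_hgf_add_intVec hact)).comp_translation p
  simp only [companion_eq]
  simpa only [add_assoc, ← intVec_add, add_sub_cancel] using h

theorem linIndepOverRat_companion (ν : SingPt) (i : Fin 3) {p q : Fin 5 → ℤ} (hpq : p ≠ q) :
    LinIndepOverRat (domain p ∩ domain q) (fun a => companion ν i (a + intVec ℂ p))
      (fun a => companion ν i (a + intVec ℂ q)) := by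
  intro U V h
  obtain ⟨hU, hV⟩ := indep_companion ν i hpq _ _ (.evalAt U) (.evalAt V) (by
    filter_upwards [eventually_mem_domain p, eventually_mem_domain q,
      (eventually_residual_regularAt U).filter_mono far_le_residual,
      (eventually_residual_regularAt V).filter_mono far_le_residual] with a hp hq hU hV
    exact h a ⟨hp, hq⟩ hU hV)
  exact ⟨eq_zero_of_eventually_evalAt hU, eq_zero_of_eventually_evalAt hV⟩

theorem eventually_of_relation {h : (Fin 5 → ℂ) → ℂ} {p q : Fin 5 → ℤ} {u v : RatFun ℚ}
    (hr : Relation h p q u v) : ∀ᶠ a in far,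
      h a = evalAt u a * h (a + intVec ℂ p) + evalAt v a * h (a + intVec ℂ q) := by
  filter_upwards [eventually_mem_domain 0, eventually_mem_domain p, eventually_mem_domain q,
    (eventually_residual_regularAt u).filter_mono far_le_residual,
    (eventually_residual_regularAt v).filter_mono far_le_residual] with a h0 hp hq hu hv
  exact hr a ⟨⟨h0, hp⟩, hq⟩ hu hv

theorem eq_of_eventually_evalAt_sub {u v : RatFun ℚ}
    (h : ∀ᶠ a in far, evalAt u a - evalAt v a = 0) : u = v :=
  eq_of_eventually_evalHom (h.mono fun a h ha => by
    rwa [← evalAt_eq_evalHom, ← evalAt_eq_evalHom, ← sub_eq_zero])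

theorem relation_unique (ν : SingPt) (i : Fin 3) {p q : Fin 5 → ℤ} (hpq : p ≠ q)
    {u v u' v' : RatFun ℚ} (h : Relation (companion ν i) p q u v)
    (h' : Relation (companion ν i) p q u' v') : u' = u ∧ v' = v := by
  obtain ⟨hu, hv⟩ := indep_companion ν i hpq _ _ ((IsRat.evalAt u').sub (.evalAt u))
    ((IsRat.evalAt v').sub (.evalAt v)) (by
      filter_upwards [eventually_of_relation h, eventually_of_relation h'] with a h h'
      linear_combination h - h')
  exact ⟨eq_of_eventually_evalAt_sub hu, eq_of_eventually_evalAt_sub hv⟩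

/-! ### The recipe -/

section Recipe

variable {p q : Fin 5 → ℤ} {l l' m : List (Fin 5 × Bool)}

theorem pathMatrix_top_row (hl : endpoint l = endpoint l') (j : Fin 2) :
    pathMatrix vars l 0 j = pathMatrix vars l' 0 j := by
  obtain ⟨h0, h1⟩ := indep_hgf_of_pos (p := 1) le_rfl _ _
    ((IsRat.evalAt (pathMatrix vars l 0 0)).sub (.evalAt (pathMatrix vars l' 0 0)))
    ((IsRat.evalAt (pathMatrix vars l 0 1)).sub (.evalAt (pathMatrix vars l' 0 1))) (by
      filter_upwards [contig_hgf.path_top l, contig_hgf.path_top l',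
        eventually_far_algebraicIndependent] with a h h' ha
      rw [hl] at h
      simp only [evalAt_pathMatrix ha, intVec_one]
      linear_combination h' - h)
  fin_cases j
  · exact eq_of_eventually_evalAt_sub h0
  · exact eq_of_eventually_evalAt_sub h1

/-- The determinant `Δ` of the top rows of the matrices of two lattice paths. -/
def topDet {K : Type*} [Field K] (a : Fin 5 → K) (l l' : List (Fin 5 × Bool)) : K :=
  pathMatrix a l 0 0 * pathMatrix a l' 0 1 - pathMatrix a l 0 1 * pathMatrix a l' 0 0

theorem evalHom_pathMatrix {a : Fin 5 → ℂ} (ha : AlgebraicIndependent ℚ a) (b : Fin 5 → RatFun ℚ)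
    (i j : Fin 2) : evalHom ha (pathMatrix b l i j) = pathMatrix (evalHom ha ∘ b) l i j := by
  rw [← map_pathMatrix, Matrix.map_apply]

theorem pathMatrix_vars_add_ne_zero (hm : endpoint m ≠ 0) (p : Fin 5 → ℤ) :
    pathMatrix (vars + intVec (RatFun ℚ) p) m 0 1 ≠ 0 := by
  obtain ⟨a, ha, hne⟩ := (eventually_far_algebraicIndependent.and
    ((tendsto_translation p).eventually (eventually_top_right_ne_zero hm))).exists
  intro h0
  have h := evalHom_pathMatrix (l := m) ha (vars + intVec (RatFun ℚ) p) 0 1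
  have hvars : evalHom ha ∘ (vars + intVec (RatFun ℚ) p) = a + intVec ℂ p := by
    conv_rhs => rw [← evalHom_vars ha]
    ext j
    simp [intVec]
  rw [h0, map_zero, hvars] at h
  exact hne h.symm

/-- The path `l` followed by `m` has the same top row as `l'`, so `Δ` expands along it as a
determinant of a product. -/
theorem topDet_eq (hm : endpoint m = endpoint l' - endpoint l) :
    topDet vars l l' =
      connDet vars (endpoint l) * pathMatrix (vars + intVec (RatFun ℚ) (endpoint l)) m 0 1 := by
  have hrow : ∀ j, pathMatrix vars l' 0 j =
      pathMatrix (vars + intVec (RatFun ℚ) (endpoint l)) m 0 0 * pathMatrix vars l 0 j +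
        pathMatrix (vars + intVec (RatFun ℚ) (endpoint l)) m 0 1 * pathMatrix vars l 1 j :=
    fun j => by
      rw [pathMatrix_top_row (l' := l ++ m) (by rw [endpoint_append, hm, add_sub_cancel]),
        pathMatrix_append, Matrix.mul_apply, Fin.sum_univ_two]
  rw [← nonInt_vars.det_pathMatrix, Matrix.det_fin_two, topDet, hrow, hrow]
  ring

theorem topDet_ne_zero (h : endpoint l ≠ endpoint l') : topDet vars l l' ≠ 0 := by
  obtain ⟨m, hm, -⟩ := exists_path (endpoint l' - endpoint l)
  rw [topDet_eq hm]
  exact mul_ne_zero (nonInt_vars.connDet_ne_zero _)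
    (pathMatrix_vars_add_ne_zero (by rw [hm]; exact sub_ne_zero.2 h.symm) _)

/-- The coefficient `u` of the three-term relation for the end points of `l` and `l'`. -/
def firstCoeff (l l' : List (Fin 5 × Bool)) : RatFun ℚ := pathMatrix vars l' 0 1 / topDet vars l l'

/-- The coefficient `v` of the three-term relation for the end points of `l` and `l'`. -/
def secondCoeff (l l' : List (Fin 5 × Bool)) : RatFun ℚ :=
  -(pathMatrix vars l 0 1 / topDet vars l l')

theorem givenByRecipe (h : endpoint l ≠ endpoint l') :
    GivenByRecipe (endpoint l) (endpoint l') (firstCoeff l l') (secondCoeff l l') := by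
  intro lp lq hp hq
  have hu : firstCoeff l l' = firstCoeff lp lq := by
    simp only [firstCoeff, topDet, pathMatrix_top_row hp, pathMatrix_top_row hq]
  have hv : secondCoeff l l' = secondCoeff lp lq := by
    simp only [secondCoeff, topDet, pathMatrix_top_row hp, pathMatrix_top_row hq]
  have hne : topDet vars lp lq ≠ 0 := topDet_ne_zero (by rwa [hp, hq])
  refine ⟨⟨hne, hu, hv⟩, fun m hm => ?_⟩
  rw [← hp, ← hq] at hm
  rw [← hp]
  simp only [← topDet_eq hm]
  exact ⟨hne, hu, hv⟩

theorem Contig.eventually_relation {h : (Fin 5 → ℂ) → ℂ} (hh : Contig h)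
    (hl : endpoint l ≠ endpoint l') : ∀ᶠ a in far,
      h a = evalAt (firstCoeff l l') a * h (a + intVec ℂ (endpoint l)) +
        evalAt (secondCoeff l l') a * h (a + intVec ℂ (endpoint l')) := by
  filter_upwards [hh.path_top l, hh.path_top l', eventually_far_algebraicIndependent]
    with a hp hq ha
  have hdet : evalHom ha (topDet vars l l') = topDet a l l' := by
    simp only [topDet, map_sub, map_mul, evalHom_pathMatrix, evalHom_vars]
  have hne : topDet a l l' ≠ 0 := by
    rw [← hdet]
    exact (map_ne_zero _).2 (topDet_ne_zero hl)
  simp only [firstCoeff, secondCoeff, evalAt_eq_evalHom ha, map_neg, map_div₀, hdet,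
    evalHom_pathMatrix, evalHom_vars]
  rw [hp, hq]
  field_simp
  rw [topDet]
  ring

end Recipe

/-! ### Analytic continuation -/

theorem shiftThree_add (b c : Fin 5 → ℂ) (t : ℂ) :
    shiftThree b t + c = shiftThree (b + c) t := by
  ext j
  simp only [Pi.add_apply, shiftThree]
  ring

theorem shiftThree_zero (b : Fin 5 → ℂ) : shiftThree b 0 = b := by
  ext j
  simp [shiftThree]

theorem shiftThree_apply_of_lt (b : Fin 5 → ℂ) (t : ℂ) {i : Fin 5} (hi : i < 3) :
    shiftThree b t i = b i := by
  simp [shiftThree, hi.ne]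

theorem differentiable_eval_shiftThree (P : MvPolynomial (Fin 5) ℂ) (b : Fin 5 → ℂ) :
    Differentiable ℂ fun t => MvPolynomial.eval (shiftThree b t) P := by
  induction P using MvPolynomial.induction_on with
  | C c => simp
  | add P Q hP hQ =>
    simp only [map_add]
    exact hP.add hQ
  | mul_X P j hP =>
    simp only [map_mul, MvPolynomial.eval_X]
    refine hP.mul ?_
    unfold shiftThree
    by_cases hj : j = 3 <;> simp only [hj, if_true, if_false] <;> fun_prop

theorem add_intVec_ne_intCast {b : Fin 5 → ℂ} {i : Fin 5} (hb : ∀ n : ℤ, b i ≠ n)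
    (p : Fin 5 → ℤ) (n : ℤ) : (b + intVec ℂ p) i ≠ n := fun h => hb (n - p i) (by
  push_cast
  exact eq_sub_of_add_eq h)

theorem continuousAt_hgf_add_intVec {b : Fin 5 → ℂ} {p : Fin 5 → ℤ}
    (hb : ∀ i < 3, ∀ n : ℤ, b i ≠ n) (hs : 0 < (saal (b + intVec ℂ p)).re) :
    ContinuousAt (fun a => hgf (a + intVec ℂ p) 1) b :=
  ContinuousAt.comp (g := fun x => hgf x 1) (f := fun a => a + intVec ℂ p)
    (continuousAt_hgf_one (fun i hi => add_intVec_ne_intCast (hb i hi) p) hs) (by fun_prop)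

theorem differentiableOn_hgf_shiftThree {b : Fin 5 → ℂ} (hb : ∀ i < 3, ∀ n : ℤ, b i ≠ n) :
    DifferentiableOn ℂ (fun t => hgf (shiftThree b t) 1) {t | 0 < (saal b).re + t.re} := by
  have hreg : (fun t => hgf (shiftThree b t) 1) = fun t =>
      Complex.Gamma (b 0) * Complex.Gamma (b 1) * Complex.Gamma (b 2) *
        regSum (shiftThree b t) := by
    funext t
    have hbt : ∀ i < 3, ∀ n : ℤ, shiftThree b t i ≠ n := fun i hi => by
      rw [shiftThree_apply_of_lt b t hi]
      exact hb i hi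
    rw [hgf_one_eq (hbt 0 (by decide)) (hbt 1 (by decide)) (hbt 2 (by decide)),
      shiftThree_apply_of_lt b t (by decide), shiftThree_apply_of_lt b t (by decide),
      shiftThree_apply_of_lt b t (by decide)]
  rw [hreg]
  exact (differentiableOn_regSum_shiftThree b).const_mul _

section Continuation

variable {ι : Type*} [Fintype ι] {P : ι → MvPolynomial (Fin 5) ℂ} {p : ι → Fin 5 → ℤ}
  {b : Fin 5 → ℂ}

theorem continuousAt_sum_eval_mul_hgf (hb : ∀ i < 3, ∀ n : ℤ, b i ≠ n)
    (hs : ∀ i, 0 < (saal (b + intVec ℂ (p i))).re) :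
    ContinuousAt (fun a => ∑ i, MvPolynomial.eval a (P i) * hgf (a + intVec ℂ (p i)) 1) b :=
  tendsto_finsetSum _ fun i _ =>
    (MvPolynomial.continuous_eval (P i)).continuousAt.mul (continuousAt_hgf_add_intVec hb (hs i))

theorem differentiableOn_sum_eval_mul_hgf_shiftThree (hb : ∀ i < 3, ∀ n : ℤ, b i ≠ n) :
    DifferentiableOn ℂ (fun t => ∑ i, MvPolynomial.eval (shiftThree b t) (P i) *
      hgf (shiftThree b t + intVec ℂ (p i)) 1)
      (⋂ i, {t | -(saal (b + intVec ℂ (p i))).re < t.re}) := by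
  simp only [shiftThree_add]
  refine .fun_sum fun i _ => (differentiable_eval_shiftThree (P i) b).differentiableOn.mul
    ((differentiableOn_hgf_shiftThree fun j hj => add_intVec_ne_intCast (hb j hj) (p i)).mono
      fun t ht => ?_)
  have hti : -(saal (b + intVec ℂ (p i))).re < t.re := Set.mem_iInter.1 ht i
  exact neg_lt_iff_pos_add'.1 hti

theorem sum_eval_mul_hgf_eq_zero
    (h : ∀ᶠ a in far, ∑ i, MvPolynomial.eval a (P i) * hgf (a + intVec ℂ (p i)) 1 = 0)
    (hb : ∀ i < 3, ∀ n : ℤ, b i ≠ n) (hs : ∀ i, 0 < (saal (b + intVec ℂ (p i))).re) :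
    ∑ i, MvPolynomial.eval b (P i) * hgf (b + intVec ℂ (p i)) 1 = 0 := by
  obtain ⟨M, hM⟩ := eventually_far.1 h
  let U : Set ℂ := ⋂ i, {t | -(saal (b + intVec ℂ (p i))).re < t.re}
  have hU : IsOpen U :=
    isOpen_iInter_of_finite fun i => isOpen_lt continuous_const Complex.continuous_re
  have hconn : IsPreconnected U :=
    (convex_iInter fun i => convex_halfSpace_re_gt _).isPreconnected
  have hzero : (0 : ℂ) ∈ U := Set.mem_iInter.2 fun i => by simpa using hs i
  obtain ⟨x, hxU, hxM⟩ : ∃ x : ℝ, (∀ i, -(saal (b + intVec ℂ (p i))).re < x) ∧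
      M - (saal b).re < x :=
    ((eventually_all.2 fun i => eventually_gt_atTop _).and (eventually_gt_atTop _)).exists
  have hxU' : (x : ℂ) ∈ U := Set.mem_iInter.2 hxU
  have hnear : ∀ᶠ t in 𝓝 (x : ℂ), ∑ i, MvPolynomial.eval (shiftThree b t) (P i) *
      hgf (shiftThree b t + intVec ℂ (p i)) 1 = 0 := by
    filter_upwards [hU.mem_nhds hxU',
      (isOpen_lt continuous_const Complex.continuous_re).mem_nhds hxM] with t htU htM
    refine eq_zero_of_continuousAt
      (continuousAt_sum_eval_mul_hgf (fun i hi => ?_) fun i => ?_) ?_ hM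
    · rw [shiftThree_apply_of_lt b t hi]
      exact hb i hi
    · rw [shiftThree_add, saal_shiftThree, Complex.add_re]
      exact neg_lt_iff_pos_add'.1 (Set.mem_iInter.1 htU i)
    · rw [saal_shiftThree, Complex.add_re]
      exact sub_lt_iff_lt_add'.1 htM
  have hb0 := ((differentiableOn_sum_eval_mul_hgf_shiftThree (P := P) (p := p)
    hb).analyticOnNhd hU).eqOn_zero_of_preconnected_of_eventuallyEq_zero hconn hxU' hnear hzero
  simpa only [shiftThree_zero, Pi.zero_apply] using hb0

end Continuation

/-! ### The relation and its symmetries -/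

theorem exists_eval_eq_aeval_act (x : S2S3S3) (P : MvPolynomial (Fin 5) ℚ) :
    ∃ P' : MvPolynomial (Fin 5) ℂ, ∀ a,
      MvPolynomial.eval a P' = MvPolynomial.aeval (act (1 : ℂ) x a) P := by
  obtain ⟨σ, hσ⟩ := exists_affineEquiv_eq_act x
  obtain ⟨P', hP'⟩ := exists_eval_comp σ (MvPolynomial.map (algebraMap ℚ ℂ) P)
  exact ⟨P', fun a => by rw [hP', hσ, aeval_eq_eval_map]⟩

section Relation

variable {l l' : List (Fin 5 × Bool)}

/-- The three-term relation for the end points of `l` and `l'`, transformed by an element `x` of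
`S₂ ⋉ (S₃ × S₃)`, at the point `a`. -/
def RelationAt (h : (Fin 5 → ℂ) → ℂ) (x : S2S3S3) (l l' : List (Fin 5 × Bool)) (a : Fin 5 → ℂ) :
    Prop :=
  h a = (((sgn x ^ saal (endpoint l) : ℤˣ) : ℤ) : ℂ) * evalAt (firstCoeff l l') (act 1 x⁻¹ a) *
      h (a + intVec ℂ (act 0 x (endpoint l))) +
    (((sgn x ^ saal (endpoint l') : ℤˣ) : ℤ) : ℂ) * evalAt (secondCoeff l l') (act 1 x⁻¹ a) *
      h (a + intVec ℂ (act 0 x (endpoint l')))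

theorem Contig.eventually_relationAt {h : (Fin 5 → ℂ) → ℂ} (hh : Contig h) (x : S2S3S3)
    (hl : endpoint l ≠ endpoint l') : ∀ᶠ a in far, RelationAt h x l l' a := by
  filter_upwards [(tendsto_act x⁻¹).eventually ((hh.comp_act x).eventually_relation hl)] with a ha
  simp only [twist_add_intVec, act_add_intVec, act_act_inv] at ha
  refine mul_left_cancel₀ (twist_ne_zero (sgn x) (act 1 x⁻¹ a)) ?_
  linear_combination ha

theorem relationAt_hgf (x : S2S3S3) (hl : endpoint l ≠ endpoint l') {a : Fin 5 → ℂ}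
    (ha : ∀ i < 3, ∀ n : ℤ, a i ≠ n) (hs : 0 < (saal a).re)
    (hp : 0 < (saal (a + intVec ℂ (act 0 x (endpoint l)))).re)
    (hq : 0 < (saal (a + intVec ℂ (act 0 x (endpoint l')))).re)
    (hu : RegularAt (firstCoeff l l') (act 1 x⁻¹ a))
    (hv : RegularAt (secondCoeff l l') (act 1 x⁻¹ a)) :
    RelationAt (fun b => hgf b 1) x l l' a := by
  have hreg : ∀ w : RatFun ℚ, ∀ᶠ b in far, RegularAt w (act 1 x⁻¹ b) := fun w =>
    (tendsto_act x⁻¹).eventually ((eventually_residual_regularAt w).filter_mono far_le_residual)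
  choose P hP using exists_eval_eq_aeval_act x⁻¹
  let num (w : RatFun ℚ) := P (IsFractionRing.num (MvPolynomial (Fin 5) ℚ) w)
  let den (w : RatFun ℚ) := P (IsFractionRing.den (MvPolynomial (Fin 5) ℚ) w)
  have heval : ∀ w b, evalAt w (act 1 x⁻¹ b) =
      MvPolynomial.eval b (num w) / MvPolynomial.eval b (den w) := fun w b => by
    rw [evalAt, hP, hP]
  have hden : ∀ {w b}, RegularAt w (act 1 x⁻¹ b) → MvPolynomial.eval b (den w) ≠ 0 :=
    fun h => by rwa [hP]
  have hu := hden hu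
  have hv := hden hv
  have hcont := sum_eval_mul_hgf_eq_zero (b := a)
    (P := ![-(den (firstCoeff l l') * den (secondCoeff l l')),
      MvPolynomial.C (((sgn x ^ saal (endpoint l) : ℤˣ) : ℤ) : ℂ) * num (firstCoeff l l') *
        den (secondCoeff l l'),
      MvPolynomial.C (((sgn x ^ saal (endpoint l') : ℤˣ) : ℤ) : ℂ) * num (secondCoeff l l') *
        den (firstCoeff l l')])
    (p := ![0, act 0 x (endpoint l), act 0 x (endpoint l')]) (by
      filter_upwards [contig_hgf.eventually_relationAt x hl, hreg (firstCoeff l l'),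
        hreg (secondCoeff l l')] with b hb hu hv
      have hu := hden hu
      have hv := hden hv
      simp only [RelationAt, heval] at hb
      simp only [Fin.sum_univ_three, Matrix.cons_val, map_neg, map_mul, MvPolynomial.eval_C,
        add_intVec_zero, hb]
      field_simp
      ring)
    ha (Fin.forall_fin_succ.2 ⟨by simpa [add_intVec_zero] using hs,
      Fin.forall_fin_two.2 ⟨hp, hq⟩⟩)
  simp only [Fin.sum_univ_three, Matrix.cons_val, map_neg, map_mul, MvPolynomial.eval_C,
    add_intVec_zero] at hcont
  simp only [RelationAt, heval]
  field_simp
  linear_combination -hcont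

/-- With `b = y a` for the group element `y` of the companion function, this is `relationAt_hgf`
for `y x` at `b`. -/
theorem relationAt_companion (x : S2S3S3) (hl : endpoint l ≠ endpoint l') (ν : SingPt) (i : Fin 3)
    {a : Fin 5 → ℂ} (ha : Generic a) (hs : 0 < (saal a).re)
    (hp : 0 < (saal (a + intVec ℂ (act 0 x (endpoint l)))).re)
    (hq : 0 < (saal (a + intVec ℂ (act 0 x (endpoint l')))).re)
    (hu : RegularAt (firstCoeff l l') (act 1 x⁻¹ a))
    (hv : RegularAt (secondCoeff l l') (act 1 x⁻¹ a)) :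
    RelationAt (companion ν i) x l l' a := by
  set y := genElt ν i
  have hinv : act 1 (y * x)⁻¹ (act 1 y a) = act 1 x⁻¹ a := by
    rw [mul_inv_rev, act_mul, act_inv_act]
  have hshift : ∀ p : Fin 5 → ℤ, act 1 y a + intVec ℂ (act 0 (y * x) p) =
      act 1 y (a + intVec ℂ (act 0 x p)) := fun p => by
    rw [act_mul, act_add_intVec]
  have hsgn : ∀ n : ℤ, (((sgn (y * x) ^ n : ℤˣ) : ℤ) : ℂ) =
      (((sgn y ^ n : ℤˣ) : ℤ) : ℂ) * (((sgn x ^ n : ℤˣ) : ℤ) : ℂ) := fun n => by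
    rw [sgn_mul, mul_zpow]
    push_cast
    rfl
  have hrel := relationAt_hgf (y * x) hl (fun j _ => (ha.act y).1 j) (by rwa [saal_act])
    (by rwa [hshift, saal_act]) (by rwa [hshift, saal_act]) (by rwa [hinv]) (by rwa [hinv])
  simp only [RelationAt, hinv, hsgn, hshift] at hrel
  simp only [RelationAt, companion_eq, twist_add_intVec, saal_act]
  rw [hrel]
  ring

theorem symRelation (hl : endpoint l ≠ endpoint l') (ν : SingPt) (i : Fin 3) (σ : symGroup) :
    SymRelation (companion ν i) σ.1 (Equiv.Perm.sign (symEquiv σ).right)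
      (endpoint l) (endpoint l') (firstCoeff l l') (secondCoeff l l') := by
  refine ⟨_, _, symGroup_linear_intVec σ _, symGroup_linear_intVec σ _, ?_⟩
  rintro a ⟨⟨⟨ha, hs⟩, -, hp⟩, -, hq⟩ hu hv
  rw [add_intVec_zero] at hs
  rw [symGroup_symm_apply] at hu hv ⊢
  exact relationAt_companion _ hl ν i ha hs hp hq hu hv

theorem relation (hl : endpoint l ≠ endpoint l') (ν : SingPt) (i : Fin 3) :
    Relation (companion ν i) (endpoint l) (endpoint l') (firstCoeff l l') (secondCoeff l l') := by
  rintro a ⟨⟨⟨ha, hs⟩, -, hp⟩, -, hq⟩ hu hv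
  rw [add_intVec_zero] at hs
  simpa only [RelationAt, inv_one, act_one, sgn_one, one_zpow, Units.val_one, Int.cast_one,
    one_mul] using relationAt_companion 1 hl ν i ha hs (by rwa [act_one]) (by rwa [act_one])
      (by rwa [inv_one, act_one]) (by rwa [inv_one, act_one])

end Relation

end ThreeTerm

end

theorem theorem1p1 :
    -- lattice paths to every integer vector `r`, of length `|r₀| + ⋯ + |r₄|`
    (∀ r : Fin 5 → ℤ, ∃ l : List (Fin 5 × Bool),
      ThreeTerm.endpoint l = r ∧ l.length = ∑ j, (r j).natAbs) ∧
    -- the symmetry group has order 72 and is `S₂ ⋉ (S₃ × S₃)`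
    Nat.card ThreeTerm.symGroup = 72 ∧
    ∃ Φ : ThreeTerm.symGroup ≃* ThreeTerm.S2S3S3,
      Φ (ThreeTerm.gen .infty 0) = SemidirectProduct.inr (Equiv.swap 0 1) ∧
      Φ (ThreeTerm.gen .zero 1) = SemidirectProduct.inl
        (Pi.mulSingle (1 : Fin 2) (Equiv.swap (0 : Fin 3) 1) : Fin 2 → Equiv.Perm (Fin 3)) ∧
      Φ (ThreeTerm.gen .zero 2) = SemidirectProduct.inl
        (Pi.mulSingle (1 : Fin 2) (Equiv.swap (0 : Fin 3) 2) : Fin 2 → Equiv.Perm (Fin 3)) ∧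
      ∀ p q : Fin 5 → ℤ, p ≠ q →
        -- linear independence over `ℂ(a)`
        (∀ ν i, ThreeTerm.LinIndepOverRat (ThreeTerm.domain p ∩ ThreeTerm.domain q)
          (fun a => ThreeTerm.companion ν i (a + ThreeTerm.intVec ℂ p))
          (fun a => ThreeTerm.companion ν i (a + ThreeTerm.intVec ℂ q))) ∧
        ∃ u v : ThreeTerm.RatFun ℚ,
          -- one and the same relation for all six functions
          (∀ ν i, ThreeTerm.Relation (ThreeTerm.companion ν i) p q u v) ∧
          -- uniqueness, for each of the six functions separately
          (∀ ν i, ∀ u' v' : ThreeTerm.RatFun ℚ,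
            ThreeTerm.Relation (ThreeTerm.companion ν i) p q u' v' → u' = u ∧ v' = v) ∧
          -- the recipe
          ThreeTerm.GivenByRecipe p q u v ∧
          -- the symmetry
          (∀ ν i, ∀ σ : ThreeTerm.symGroup,
            ThreeTerm.SymRelation (ThreeTerm.companion ν i) σ.1
              (Equiv.Perm.sign (Φ σ).right) p q u v) := by
  refine ⟨ThreeTerm.exists_path, ThreeTerm.card_symGroup, ThreeTerm.symEquiv,
    (ThreeTerm.symEquiv_gen _ _).trans ThreeTerm.genElt_infty_zero,
    ThreeTerm.symEquiv_gen _ _, ThreeTerm.symEquiv_gen _ _, fun p q hpq => ?_⟩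
  refine ⟨fun ν i => ThreeTerm.linIndepOverRat_companion ν i hpq, ?_⟩
  obtain ⟨l, rfl, -⟩ := ThreeTerm.exists_path p
  obtain ⟨l', rfl, -⟩ := ThreeTerm.exists_path q
  exact ⟨ThreeTerm.firstCoeff l l', ThreeTerm.secondCoeff l l', ThreeTerm.relation hpq,
    fun ν i u' v' h' => ThreeTerm.relation_unique ν i hpq (ThreeTerm.relation hpq ν i) h',
    ThreeTerm.givenByRecipe hpq, ThreeTerm.symRelation hpq⟩
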